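/- Let $G=\mathrm{SO}_5(\mathbb{C})$, with a maximal torus $T$ and a Borel subgroup $B\supseteq T$. Let $\varepsilon_1,\varepsilon_2$ be the standard basis of the character lattice of $T$, chosen so that the positive roots (the roots of $B$) are $\varepsilon_1-\varepsilon_2$, $\varepsilon_1+\varepsilon_2$, $\varepsilon_1$, $\varepsilon_2$, and write $(m_1,m_2)$ for the weight $m_1\varepsilon_1+m_2\varepsilon_2$. Let $\lambda_1\ge\lambda_2\ge 0$ be integers, and let $V$ be an irreducible finite-dimensional rational representation of $G$ with highest weight $(\lambda_1,\lambda_2)$. Then the dimension of its zero weight space $V_0=\{v\in V : tv=v \text{ for all } t\in T\}$ is $$\dim V_0=\begin{cases}(\lambda_1-\lambda_2)\lambda_2+\dfrac{\lambda_1+\lambda_2}{2}+1 & \text{if } \lambda_1+\lambda_2 \text{ is even},\\[2mm](\lambda_1-\lambda_2)\lambda_2+\dfrac{\lambda_1+\lambda_2}{2}+\dfrac12 & \text{if } \lambda_1+\lambda_2\text{ is odd}.\end{cases}$$ -/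

import Mathlib

namespace SO5

/-- The complex special orthogonal group `SO₅(ℂ)`: the complex matrices with `g gᵀ = 1` and
`det g = 1` (no complex conjugation is involved). -/
abbrev G : Type := ↥(Matrix.specialOrthogonalGroup (Fin 5) ℂ)

/-- The matrix of the rotation by `z` in the first and by `w` in the second coordinate plane. It
multiplies `e₀ + i e₁`, `e₀ - i e₁`, `e₂ + i e₃`, `e₂ - i e₃`, `e₄` by
`z`, `z⁻¹`, `w`, `w⁻¹`, `1` respectively. -/
noncomputable def torusMatrix (z w : ℂˣ) : Matrix (Fin 5) (Fin 5) ℂ :=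
  !![((z : ℂ) + (z : ℂ)⁻¹) / 2, -(Complex.I * ((z : ℂ) - (z : ℂ)⁻¹) / 2), 0, 0, 0;
     Complex.I * ((z : ℂ) - (z : ℂ)⁻¹) / 2, ((z : ℂ) + (z : ℂ)⁻¹) / 2, 0, 0, 0;
     0, 0, ((w : ℂ) + (w : ℂ)⁻¹) / 2, -(Complex.I * ((w : ℂ) - (w : ℂ)⁻¹) / 2), 0;
     0, 0, Complex.I * ((w : ℂ) - (w : ℂ)⁻¹) / 2, ((w : ℂ) + (w : ℂ)⁻¹) / 2, 0;
     0, 0, 0, 0, 1]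

theorem torusMatrix_mem (z w : ℂˣ) :
    torusMatrix z w ∈ Matrix.specialOrthogonalGroup (Fin 5) ℂ := by
  have key : ∀ u : ℂˣ, (((u : ℂ) + (u : ℂ)⁻¹) / 2) * (((u : ℂ) + (u : ℂ)⁻¹) / 2) +
      (Complex.I * ((u : ℂ) - (u : ℂ)⁻¹) / 2) * (Complex.I * ((u : ℂ) - (u : ℂ)⁻¹) / 2) = 1 := by
    intro u
    have hu : (u : ℂ) * (u : ℂ)⁻¹ = 1 := mul_inv_cancel₀ u.ne_zero
    linear_combination hu + (((u : ℂ) - (u : ℂ)⁻¹) ^ 2 / 4) * Complex.I_sq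
  have hz := key z
  have hw := key w
  rw [Matrix.mem_specialOrthogonalGroup_iff, Matrix.mem_orthogonalGroup_iff]
  unfold torusMatrix
  generalize ((z : ℂ) + (z : ℂ)⁻¹) / 2 = a at hz ⊢
  generalize Complex.I * ((z : ℂ) - (z : ℂ)⁻¹) / 2 = b at hz ⊢
  generalize ((w : ℂ) + (w : ℂ)⁻¹) / 2 = c at hw ⊢
  generalize Complex.I * ((w : ℂ) - (w : ℂ)⁻¹) / 2 = d at hw ⊢
  constructor
  · ext i j
    fin_cases i <;> fin_cases j <;>
      simp [Matrix.mul_apply, Fin.sum_univ_succ] <;> grind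
  · simp [Matrix.det_succ_row_zero, Fin.sum_univ_succ, Fin.succAbove]
    linear_combination hz * (c * c + d * d) + hw

/-- The elements of the maximal torus `T = {t(z, w) : z, w ∈ ℂˣ}` of `SO₅(ℂ)`. -/
noncomputable def torus (z w : ℂˣ) : G := ⟨torusMatrix z w, torusMatrix_mem z w⟩

/-- The isotropic vector `e₀ + i e₁`. -/
noncomputable def isoVec₁ : Fin 5 → ℂ := ![1, Complex.I, 0, 0, 0]

/-- The isotropic vector `e₂ + i e₃`. -/
noncomputable def isoVec₂ : Fin 5 → ℂ := ![0, 0, 1, Complex.I, 0]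

/-- The Borel subgroup `B ⊇ T` of `SO₅(ℂ)`: the stabilizer of the complete isotropic flag
`⟨e₀ + i e₁⟩ ⊂ ⟨e₀ + i e₁, e₂ + i e₃⟩` of `ℂ⁵`. Its positive roots are
`ε₁ - ε₂`, `ε₁ + ε₂`, `ε₁`, `ε₂`, where `εᵢ` are the two coordinate characters of `T`. -/
noncomputable def borel : Subgroup G where
  carrier := {g |
    (ℂ ∙ isoVec₁).map (Matrix.mulVecLin g.1) = ℂ ∙ isoVec₁ ∧
    (Submodule.span ℂ {isoVec₁, isoVec₂}).map (Matrix.mulVecLin g.1) =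
      Submodule.span ℂ {isoVec₁, isoVec₂}}
  one_mem' := by simp
  mul_mem' := by
    rintro g h ⟨hg1, hg2⟩ ⟨hh1, hh2⟩
    refine ⟨?_, ?_⟩
    · rw [Submonoid.coe_mul, Matrix.mulVecLin_mul, Submodule.map_comp, hh1, hg1]
    · rw [Submonoid.coe_mul, Matrix.mulVecLin_mul, Submodule.map_comp, hh2, hg2]
  inv_mem' := by
    rintro g ⟨hg1, hg2⟩
    have h : Matrix.mulVecLin (g⁻¹ : G).1 ∘ₗ Matrix.mulVecLin g.1 = LinearMap.id := by
      rw [← Matrix.mulVecLin_mul, ← Submonoid.coe_mul, inv_mul_cancel, Submonoid.coe_one,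
        Matrix.mulVecLin_one]
    refine ⟨?_, ?_⟩
    · conv_lhs => rw [← hg1]
      rw [← Submodule.map_comp, h, Submodule.map_id]
    · conv_lhs => rw [← hg2]
      rw [← Submodule.map_comp, h, Submodule.map_id]

variable {V : Type*} [AddCommGroup V] [Module ℂ V]

/-- A representation of the algebraic group `SO₅(ℂ)` is rational (algebraic) if its matrix
coefficients are polynomial functions of the matrix entries. -/
def IsRational (ρ : Representation ℂ G V) : Prop :=
  ∀ (φ : Module.Dual ℂ V) (v : V), ∃ p : MvPolynomial (Fin 5 × Fin 5) ℂ,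
    ∀ g : G, φ (ρ g v) = MvPolynomial.eval (fun ij => g.1 ij.1 ij.2) p

/-- The weight space of the weight `(m₁, m₂) = m₁ ε₁ + m₂ ε₂`: the vectors on which the torus acts
through the character `t(z, w) ↦ z ^ m₁ * w ^ m₂`. -/
def weightSpace (ρ : Representation ℂ G V) (m₁ m₂ : ℤ) : Submodule ℂ V where
  carrier := {v | ∀ z w : ℂˣ, ρ (torus z w) v = ((z : ℂ) ^ m₁ * (w : ℂ) ^ m₂) • v}
  zero_mem' := by simp
  add_mem' := by
    intro u v hu hv z w
    rw [map_add, hu z w, hv z w, smul_add]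
  smul_mem' := by
    intro c v hv z w
    rw [map_smul, hv z w, smul_comm]

/-- `(l₁, l₂)` is the highest weight of the irreducible representation `ρ`: there is a nonzero
vector of that weight which spans a `B`-stable line. -/
def HasHighestWeight (ρ : Representation ℂ G V) (l₁ l₂ : ℤ) : Prop :=
  ∃ v : V, v ≠ 0 ∧ v ∈ weightSpace ρ l₁ l₂ ∧ ∀ b ∈ borel, ρ b v ∈ ℂ ∙ v

end SO5

/-! The proof derives Weyl's character formula for this group from a Casimir computation, then
extracts the zero weight multiplicity by a lattice point count. Differentiating $\rho$ gives an
action of the skew-symmetric matrices. Since $\mathrm{SO}_5$ is generated by half-turns, each lying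
on a one-parameter group, subspaces stable under this action are $G$-stable. Hence $V$ is spanned by
the vectors obtained from the highest weight vector by lowering operators; this bounds the weights
and makes the top multiplicity 1. The Casimir operator acts by the scalar
$|\lambda+\delta|^2-|\delta|^2$, where $2\delta=(3,1)$ is the sum of the positive roots. Taking
traces on weight spaces and using the $\mathfrak{sl}_2$ relations (`casimir_trace`, `rootTrace_sub`)
shows that the character times the Weyl denominator is supported on $|\mu+\delta|=|\lambda+\delta|$
(`weylNum_laplace`). This product is antisymmetric under the shifted Weyl group, and $\lambda$ is
the only dominant weight in its support, so it is the alternating sum over the orbit of $\lambda$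
(`weylNum_eq`). Dividing by the short root factors gives an alternating sum of quadrants
(`longNum_eq`); dividing by the long root factors writes $m(0,0)$ as a sum over the points
$(j+k,k-j)$ (`eq_sum_longNum`). There the alternating sum is the indicator of $\lambda_2\le
j+k\le\lambda_1$, $|k-j|\le\lambda_2$, the branching rule to $\mathrm{SO}_4$; `card_strip` counts
these points. -/

namespace SO5

/-! ### The differential of a rational representation. -/

open MvPolynomial in
theorem hasDerivAt_eval {σ : Type*} [Fintype σ] (p : MvPolynomial σ ℂ) {γ : ℂ → σ → ℂ}
    {γ' : σ → ℂ} {t : ℂ} (h : ∀ i, HasDerivAt (fun s => γ s i) (γ' i) t) :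
    HasDerivAt (fun s => eval (γ s) p) (∑ i, γ' i * eval (γ t) (pderiv i p)) t := by
  classical
  induction p using MvPolynomial.induction_on with
  | C a => simpa using hasDerivAt_const t a
  | add p q hp hq =>
    simp only [map_add]
    exact (hp.fun_add hq).congr_deriv (by simp [mul_add, Finset.sum_add_distrib])
  | mul_X p i hp =>
    simp only [map_mul, eval_X]
    refine (hp.fun_mul (h i)).congr_deriv ?_
    simp only [map_mul, eval_X, Derivation.leibniz, pderiv_X, smul_eq_mul, map_add]
    symm
    simp only [mul_add, Finset.sum_add_distrib, Pi.single_apply]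
    rw [add_comm, Finset.sum_mul]
    congr 1
    · exact Finset.sum_congr rfl fun j _ => by ring
    · rw [Finset.sum_eq_single i]
      · simp; ring
      · intro j _ hj
        simp [hj.symm]
      · simp

variable {V : Type*} [AddCommGroup V] [Module ℂ V]

/-- `γ` is a curve in `SO₅(ℂ)` through `1` with tangent vector `A`. -/
def HasTangent (γ : ℂ → G) (A : Matrix (Fin 5) (Fin 5) ℂ) : Prop :=
  γ 0 = 1 ∧ ∀ i j, HasDerivAt (fun s => (γ s).1 i j) (A i j) 0

/-- `d` is a differential of `ρ` at the identity. -/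
def IsDifferential (ρ : Representation ℂ G V)
    (d : Matrix (Fin 5) (Fin 5) ℂ →ₗ[ℂ] Module.End ℂ V) : Prop :=
  ∀ γ A, HasTangent γ A → ∀ (φ : Module.Dual ℂ V) (v : V),
    HasDerivAt (fun s => φ (ρ (γ s) v)) (φ (d A v)) 0

/-- The matrix coefficients are polynomials, so their linear parts at the identity define $d$ on all
matrices. Off the skew-symmetric matrices $d$ depends on the chosen polynomials; only its values on
tangent vectors carry meaning. -/
theorem exists_isDifferential [FiniteDimensional ℂ V] {ρ : Representation ℂ G V}
    (hrat : IsRational ρ) : ∃ d, IsDifferential ρ d := by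
  classical
  let b := Module.finBasis ℂ V
  choose p hp using fun i j => hrat (b.coord i) (b j)
  let one : Fin 5 × Fin 5 → ℂ := fun kl => (1 : Matrix (Fin 5) (Fin 5) ℂ) kl.1 kl.2
  let D : Matrix (Fin 5) (Fin 5) ℂ →ₗ[ℂ] Matrix _ _ ℂ :=
    { toFun := fun A i j => ∑ kl : Fin 5 × Fin 5, A kl.1 kl.2 *
        MvPolynomial.eval one (MvPolynomial.pderiv kl (p i j))
      map_add' := fun A B => by
        ext i j; simp only [Matrix.add_apply, add_mul, Finset.sum_add_distrib]; rfl
      map_smul' := fun c A => by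
        ext i j; simp only [Matrix.smul_apply, smul_eq_mul, mul_assoc, ← Finset.mul_sum]; rfl }
  refine ⟨(Matrix.toLin b b).toLinearMap ∘ₗ D, ?_⟩
  rintro γ A ⟨h1, hγ⟩ φ v
  have expand : ∀ f : Module.End ℂ V,
      φ (f v) = ∑ i, ∑ j, φ (b i) * b.coord i (f (b j)) * b.coord j v := by
    intro f
    conv_lhs => rw [← b.sum_repr v]
    rw [map_sum, map_sum, Finset.sum_comm]
    refine Finset.sum_congr rfl fun j _ => ?_
    conv_lhs => rw [map_smul, ← b.sum_repr (f (b j))]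
    simp only [map_smul, map_sum, smul_eq_mul, Module.Basis.coord_apply, Finset.mul_sum]
    exact Finset.sum_congr rfl fun i _ => by ring
  simp only [expand]
  refine HasDerivAt.fun_sum fun i _ => HasDerivAt.fun_sum fun j _ => ?_
  refine HasDerivAt.mul_const (HasDerivAt.const_mul _ ?_) _
  simp only [hp]
  have key := hasDerivAt_eval (p i j) (γ := fun s ij => (γ s).1 ij.1 ij.2)
    (γ' := fun ij => A ij.1 ij.2) (t := 0) (fun ij => hγ _ _)
  refine key.congr_deriv ?_
  have e : (fun ij : Fin 5 × Fin 5 => (γ 0).1 ij.1 ij.2) = one := by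
    rw [h1]; rfl
  rw [e]
  simp [D, Matrix.toLin_self, Finsupp.single_apply]
  rfl

/-- The bivector `u ∧ v`, as the skew-symmetric matrix `u vᵀ - v uᵀ`. -/
def wedge (u v : Fin 5 → ℂ) : Matrix (Fin 5) (Fin 5) ℂ :=
  Matrix.vecMulVec u v - Matrix.vecMulVec v u

theorem skew_eq_sum {A : Matrix (Fin 5) (Fin 5) ℂ} (hA : A.transpose = -A) :
    A = ∑ i, ∑ j, (A i j / 2) • wedge (Pi.single i 1) (Pi.single j 1) := by
  ext k l
  have h : A l k = - A k l := by
    have := congr_fun (congr_fun hA k) l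
    simpa using this
  simp only [wedge, Matrix.sum_apply, Matrix.smul_apply, Matrix.sub_apply, Matrix.vecMulVec_apply,
    Pi.single_apply, smul_eq_mul, mul_sub, Finset.sum_sub_distrib]
  simp [h]
  ring

theorem wedge_transpose (u v : Fin 5 → ℂ) : (wedge u v).transpose = - wedge u v := by
  simp [wedge, Matrix.transpose_vecMulVec]

theorem mul_wedge_mul (g : Matrix (Fin 5) (Fin 5) ℂ) (u v : Fin 5 → ℂ) :
    g * wedge u v * g.transpose = wedge (g.mulVec u) (g.mulVec v) := by
  simp [wedge, mul_sub, sub_mul, Matrix.mul_vecMulVec, Matrix.vecMulVec_mul, Matrix.vecMul_transpose]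

theorem coe_inv (g : G) : (g⁻¹ : G).1 = g.1.transpose := rfl

theorem mul_transpose_coe (g : G) : g.1 * g.1.transpose = 1 := by
  rw [← coe_inv, ← Submonoid.coe_mul, mul_inv_cancel]; rfl

theorem transpose_mul_coe (g : G) : g.1.transpose * g.1 = 1 := by
  rw [← coe_inv, ← Submonoid.coe_mul, inv_mul_cancel]; rfl

/-- The determinant of a square of an orthogonal matrix is $(\pm1)^2=1$. One-parameter groups have
square roots at half the parameter, which avoids computing their determinants. -/
theorem mem_G_of_sq {A B : Matrix (Fin 5) (Fin 5) ℂ} (h : A * A.transpose = 1) (hB : A = B * B)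
    (h' : B * B.transpose = 1) : A ∈ Matrix.specialOrthogonalGroup (Fin 5) ℂ := by
  rw [Matrix.mem_specialOrthogonalGroup_iff, Matrix.mem_orthogonalGroup_iff]
  refine ⟨h, ?_⟩
  have := congr_arg Matrix.det h'
  rwa [Matrix.det_mul, Matrix.det_transpose, Matrix.det_one, ← Matrix.det_mul, ← hB] at this

/-! ### One-parameter subgroups: rotations and unipotents. -/

section Rotation

/-- The rotation by the complex angle `t` in the plane spanned by `u` and `v`. -/
noncomputable def rotMatrix (u v : Fin 5 → ℂ) (t : ℂ) : Matrix (Fin 5) (Fin 5) ℂ :=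
  1 + Complex.sin t • wedge u v + (1 - Complex.cos t) • (wedge u v * wedge u v)

variable {u v : Fin 5 → ℂ}

theorem wedge_mul_wedge (hu : u ⬝ᵥ u = 1) (hv : v ⬝ᵥ v = 1) (huv : u ⬝ᵥ v = 0) :
    wedge u v * wedge u v = -(Matrix.vecMulVec u u + Matrix.vecMulVec v v) := by
  have hvu : v ⬝ᵥ u = 0 := by rw [dotProduct_comm, huv]
  simp only [wedge, mul_sub, sub_mul, Matrix.vecMulVec_mul_vecMulVec, hu, hv, huv, hvu]
  simp
  abel

theorem wedge_cube (hu : u ⬝ᵥ u = 1) (hv : v ⬝ᵥ v = 1) (huv : u ⬝ᵥ v = 0) :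
    wedge u v * wedge u v * wedge u v = -wedge u v := by
  have hvu : v ⬝ᵥ u = 0 := by rw [dotProduct_comm, huv]
  rw [wedge_mul_wedge hu hv huv]
  simp only [wedge, mul_sub, neg_mul, add_mul, Matrix.vecMulVec_mul_vecMulVec, hu, hv, huv, hvu]
  simp
  abel

/-- With $K=u\wedge v$ and $K^3=-K$, `rotMatrix` is Rodrigues' closed form of $\exp(tK)$, so the law
reduces to the addition formulas. -/
theorem rotMatrix_add (hu : u ⬝ᵥ u = 1) (hv : v ⬝ᵥ v = 1) (huv : u ⬝ᵥ v = 0) (s t : ℂ) :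
    rotMatrix u v (s + t) = rotMatrix u v s * rotMatrix u v t := by
  have h3 := wedge_cube hu hv huv
  unfold rotMatrix
  generalize wedge u v = K at h3
  have h3' : K * (K * K) = -K := by rw [← mul_assoc, h3]
  have h4 : K * K * (K * K) = -(K * K) := by rw [← mul_assoc, h3, neg_mul]
  simp only [mul_add, add_mul, mul_one, one_mul, smul_mul_assoc, mul_smul_comm, h3, h3', h4,
    Complex.sin_add, Complex.cos_add]
  module

theorem rotMatrix_zero : rotMatrix u v 0 = 1 := by simp [rotMatrix]

theorem rotMatrix_transpose (t : ℂ) : (rotMatrix u v t).transpose = rotMatrix u v (-t) := by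
  simp [rotMatrix, Matrix.transpose_mul, wedge_transpose]

theorem rotMatrix_mem (hu : u ⬝ᵥ u = 1) (hv : v ⬝ᵥ v = 1) (huv : u ⬝ᵥ v = 0) (t : ℂ) :
    rotMatrix u v t ∈ Matrix.specialOrthogonalGroup (Fin 5) ℂ := by
  have h : ∀ s, rotMatrix u v s * (rotMatrix u v s).transpose = 1 := fun s => by
    rw [rotMatrix_transpose, ← rotMatrix_add hu hv huv, add_neg_cancel, rotMatrix_zero]
  refine mem_G_of_sq (B := rotMatrix u v (t / 2)) (h _) ?_ (h _)
  rw [← rotMatrix_add hu hv huv, add_halves]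

/-- The rotation by the complex angle `t` in the plane with orthonormal basis `u`, `v`. -/
noncomputable def rot (hu : u ⬝ᵥ u = 1) (hv : v ⬝ᵥ v = 1) (huv : u ⬝ᵥ v = 0) (t : ℂ) : G :=
  ⟨rotMatrix u v t, rotMatrix_mem hu hv huv t⟩

theorem rot_add (hu : u ⬝ᵥ u = 1) (hv : v ⬝ᵥ v = 1) (huv : u ⬝ᵥ v = 0) (s t : ℂ) :
    rot hu hv huv (s + t) = rot hu hv huv s * rot hu hv huv t :=
  Subtype.ext (rotMatrix_add hu hv huv s t)

theorem hasTangent_rot (hu : u ⬝ᵥ u = 1) (hv : v ⬝ᵥ v = 1) (huv : u ⬝ᵥ v = 0) :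
    HasTangent (rot hu hv huv) (wedge u v) := by
  refine ⟨Subtype.ext rotMatrix_zero, fun i j => ?_⟩
  refine ((((Complex.hasDerivAt_sin 0).mul_const (wedge u v i j)).const_add
    ((1 : Matrix (Fin 5) (Fin 5) ℂ) i j)).fun_add
    (((Complex.hasDerivAt_cos 0).const_sub 1).mul_const ((wedge u v * wedge u v) i j))).congr_deriv ?_
  simp

end Rotation

section Unipotent

/-- The one-parameter group `exp (t A)` of a matrix with `A³ = 0`. -/
noncomputable def unipMatrix (A : Matrix (Fin 5) (Fin 5) ℂ) (t : ℂ) : Matrix (Fin 5) (Fin 5) ℂ :=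
  1 + t • A + (t ^ 2 / 2) • (A * A)

variable {A : Matrix (Fin 5) (Fin 5) ℂ}

theorem unipMatrix_add (hA : A * A * A = 0) (s t : ℂ) :
    unipMatrix A (s + t) = unipMatrix A s * unipMatrix A t := by
  have h3' : A * (A * A) = 0 := by rw [← mul_assoc, hA]
  have h4 : A * A * (A * A) = 0 := by rw [← mul_assoc, hA, zero_mul]
  simp only [unipMatrix, mul_add, add_mul, mul_one, one_mul, smul_mul_assoc, mul_smul_comm, hA, h3',
    h4]
  module

theorem unipMatrix_zero : unipMatrix A 0 = 1 := by simp [unipMatrix]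

theorem unipMatrix_mem (hA : A * A * A = 0) (hA' : A.transpose = -A) (t : ℂ) :
    unipMatrix A t ∈ Matrix.specialOrthogonalGroup (Fin 5) ℂ := by
  have h : ∀ s, unipMatrix A s * (unipMatrix A s).transpose = 1 := fun s => by
    have : (unipMatrix A s).transpose = unipMatrix A (-s) := by
      simp [unipMatrix, Matrix.transpose_mul, hA']
    rw [this, ← unipMatrix_add hA, add_neg_cancel, unipMatrix_zero]
  refine mem_G_of_sq (B := unipMatrix A (t / 2)) (h _) ?_ (h _)
  rw [← unipMatrix_add hA, add_halves]

/-- The unipotent one-parameter subgroup of a skew-symmetric matrix with `A³ = 0`. -/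
noncomputable def unip (hA : A * A * A = 0) (hA' : A.transpose = -A) (t : ℂ) : G :=
  ⟨unipMatrix A t, unipMatrix_mem hA hA' t⟩

theorem hasTangent_unip (hA : A * A * A = 0) (hA' : A.transpose = -A) :
    HasTangent (unip hA hA') A := by
  refine ⟨Subtype.ext unipMatrix_zero, fun i j => ?_⟩
  refine ((((hasDerivAt_id (0 : ℂ)).mul_const (A i j)).const_add
    ((1 : Matrix (Fin 5) (Fin 5) ℂ) i j)).fun_add
    (((hasDerivAt_pow 2 (0 : ℂ)).div_const 2).mul_const ((A * A) i j))).congr_deriv ?_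
  simp

end Unipotent

end SO5

namespace SO5

/-! ### The Lie algebra action and its integration along one-parameter groups. -/

section Differential

variable {V : Type*} [AddCommGroup V] [Module ℂ V] {ρ : Representation ℂ G V}
  {d : Matrix (Fin 5) (Fin 5) ℂ →ₗ[ℂ] Module.End ℂ V}

theorem eq_of_forall_dual {x y : V} (h : ∀ φ : Module.Dual ℂ V, φ x = φ y) : x = y := by
  rw [← sub_eq_zero, ← Module.forall_dual_apply_eq_zero_iff ℂ]
  intro φ
  rw [map_sub, h, sub_self]

theorem HasTangent.hasDerivAt_conj {γ : ℂ → G} {B : Matrix (Fin 5) (Fin 5) ℂ}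
    (h : HasTangent γ B) (A : Matrix (Fin 5) (Fin 5) ℂ) (k l : Fin 5) :
    HasDerivAt (fun s => ((γ s).1 * A * (γ s).1.transpose) k l)
      ((B * A + A * B.transpose) k l) 0 := by
  have h0 : (γ 0).1 = 1 := by rw [h.1]; rfl
  have : ∀ s, ((γ s).1 * A * (γ s).1.transpose) k l =
      ∑ j, (∑ i, (γ s).1 k i * A i j) * (γ s).1 l j := fun s => by
    simp [Matrix.mul_apply]
  simp only [this]
  refine (HasDerivAt.fun_sum fun j _ => (HasDerivAt.fun_sum fun i _ =>
    (h.2 k i).mul_const (A i j)).fun_mul (h.2 l j)).congr_deriv ?_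
  simp [h0, Matrix.mul_apply, Finset.sum_add_distrib, Matrix.one_apply]

theorem HasTangent.conj {γ : ℂ → G} {A : Matrix (Fin 5) (Fin 5) ℂ}
    (h : HasTangent γ A) (g : G) :
    HasTangent (fun s => g * γ s * g⁻¹) (g.1 * A * g.1.transpose) := by
  refine ⟨by simp [h.1], fun i j => ?_⟩
  have : ∀ s, (g * γ s * g⁻¹ : G).1 i j =
      ∑ l, (∑ k, g.1 i k * (γ s).1 k l) * g.1 j l := fun s => by
    simp [Matrix.mul_apply, coe_inv]
  simp only [this]
  refine (HasDerivAt.fun_sum fun l _ => (HasDerivAt.fun_sum fun k _ =>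
    (h.2 k l).const_mul (g.1 i k)).mul_const (g.1 j l)).congr_deriv ?_
  simp [Matrix.mul_apply]

theorem IsDifferential.conj_of_hasTangent (hd : IsDifferential ρ d) {γ : ℂ → G}
    {A : Matrix (Fin 5) (Fin 5) ℂ} (h : HasTangent γ A) (g : G) :
    ρ g * d A * ρ g⁻¹ = d (g.1 * A * g.1.transpose) := by
  ext v
  refine eq_of_forall_dual fun φ => ?_
  refine HasDerivAt.unique (hd γ A h (φ ∘ₗ ρ g) (ρ g⁻¹ v)) ?_
  have := hd _ _ (h.conj g) φ v
  simp only [map_mul, Module.End.mul_apply] at this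
  exact this

theorem single_dotProduct_single (i j : Fin 5) :
    (Pi.single i 1 : Fin 5 → ℂ) ⬝ᵥ Pi.single j 1 = if i = j then 1 else 0 := by
  simp [Pi.single_apply, eq_comm]

theorem wedge_self (u : Fin 5 → ℂ) : wedge u u = 0 := by simp [wedge]

/-- A linear condition that holds for the tangent matrices holds for all skew-symmetric ones. -/
theorem skew_induction {M : Type*} [AddCommGroup M] [Module ℂ M]
    {f g : Matrix (Fin 5) (Fin 5) ℂ →ₗ[ℂ] M} (h : ∀ γ A, HasTangent γ A → f A = g A)
    {A : Matrix (Fin 5) (Fin 5) ℂ} (hA : A.transpose = -A) : f A = g A := by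
  rw [skew_eq_sum hA]
  simp only [map_sum, map_smul]
  refine Finset.sum_congr rfl fun i _ => Finset.sum_congr rfl fun j _ => ?_
  congr 1
  by_cases hij : i = j
  · rw [hij, wedge_self, map_zero, map_zero]
  · exact h _ _ (hasTangent_rot (by simp) (by simp) (by simp [hij]))

theorem IsDifferential.conj (hd : IsDifferential ρ d) (g : G)
    {A : Matrix (Fin 5) (Fin 5) ℂ} (hA : A.transpose = -A) :
    ρ g * d A * ρ g⁻¹ = d (g.1 * A * g.1.transpose) :=
  skew_induction
    (f := LinearMap.mulLeft ℂ (ρ g) ∘ₗ LinearMap.mulRight ℂ (ρ g⁻¹) ∘ₗ d)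
    (g := d ∘ₗ LinearMap.mulLeft ℂ g.1 ∘ₗ LinearMap.mulRight ℂ g.1.transpose)
    (fun γ A h => by simpa [mul_assoc] using hd.conj_of_hasTangent h g) hA |> fun h => by
      simpa [mul_assoc] using h

theorem IsDifferential.apply_conj (hd : IsDifferential ρ d) (g : G)
    {A : Matrix (Fin 5) (Fin 5) ℂ} (hA : A.transpose = -A) (v : V) :
    ρ g (d A v) = d (g.1 * A * g.1.transpose) (ρ g v) := by
  rw [← hd.conj g hA, Module.End.mul_apply, Module.End.mul_apply, ρ.inv_self_apply]

/-- Both sides come from differentiating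
$\rho(\gamma_s)\,d(A)v=d(\gamma_sA\gamma_s^{T})\,\rho(\gamma_s)v$ at $s=0$. Expanding $d$ in matrix
units reduces the right side to the product rule for scalar functions. -/
theorem IsDifferential.bracket_of_hasTangent (hd : IsDifferential ρ d) {γ : ℂ → G}
    {A B : Matrix (Fin 5) (Fin 5) ℂ} (h : HasTangent γ B) (hA : A.transpose = -A) :
    d (B * A + A * B.transpose) = d B * d A - d A * d B := by
  have expand : ∀ M : Matrix (Fin 5) (Fin 5) ℂ,
      d M = ∑ k, ∑ l, M k l • d (Matrix.single k l 1) := fun M => by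
    conv_lhs => rw [Matrix.matrix_eq_sum_single M]
    simp only [map_sum]
    refine Finset.sum_congr rfl fun k _ => Finset.sum_congr rfl fun l _ => ?_
    rw [← map_smul, Matrix.smul_single, smul_eq_mul, mul_one]
  rw [eq_sub_iff_add_eq]
  ext v
  refine eq_of_forall_dual fun φ => ?_
  have h1 := hd γ B h φ (d A v)
  simp only [hd.apply_conj _ hA] at h1
  refine HasDerivAt.unique ?_ h1
  have : ∀ s, φ (d ((γ s).1 * A * (γ s).1.transpose) (ρ (γ s) v)) =
      ∑ k, ∑ l, ((γ s).1 * A * (γ s).1.transpose) k l *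
        (φ ∘ₗ d (Matrix.single k l 1)) (ρ (γ s) v) := fun s => by
    rw [expand]; simp
  simp only [this]
  refine (HasDerivAt.fun_sum fun k _ => HasDerivAt.fun_sum fun l _ =>
    (h.hasDerivAt_conj A k l).fun_mul (hd γ B h _ v)).congr_deriv ?_
  rw [LinearMap.add_apply, Module.End.mul_apply, expand (_ + _), expand A]
  simp [h.1, Finset.sum_add_distrib]

theorem IsDifferential.bracket (hd : IsDifferential ρ d)
    {A B : Matrix (Fin 5) (Fin 5) ℂ} (hB : B.transpose = -B) (hA : A.transpose = -A) :
    d (B * A - A * B) = d B * d A - d A * d B := by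
  have := skew_induction
    (f := d ∘ₗ (LinearMap.mulRight ℂ A + LinearMap.mulLeft ℂ A ∘ₗ
      (Matrix.transposeLinearEquiv (Fin 5) (Fin 5) ℂ ℂ).toLinearMap))
    (g := (LinearMap.mulRight ℂ (d A) - LinearMap.mulLeft ℂ (d A)) ∘ₗ d)
    (fun γ B h => by simpa using hd.bracket_of_hasTangent h hA) hB
  simpa [hB, sub_eq_add_neg] using this

/-- For a functional $\varphi$ vanishing on $W$, the function $s\mapsto\varphi(\rho(\gamma_s)w)$ is
entire with Taylor coefficients proportional to $\varphi(d(A)^nw)=0$, hence it vanishes. -/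
theorem IsDifferential.oneParam_mem (hd : IsDifferential ρ d) {W : Submodule ℂ V} {γ : ℂ → G}
    {A : Matrix (Fin 5) (Fin 5) ℂ} (h : HasTangent γ A) (hγ : ∀ s t, γ (s + t) = γ s * γ t)
    (hW : ∀ w ∈ W, d A w ∈ W) {w : V} (hw : w ∈ W) (t : ℂ) : ρ (γ t) w ∈ W := by
  rw [← Subspace.forall_mem_dualAnnihilator_apply_eq_zero_iff]
  intro φ hφ
  have hderiv : ∀ (x : V) (t : ℂ),
      HasDerivAt (fun s => φ (ρ (γ s) x)) (φ (ρ (γ t) (d A x))) t := fun x t => by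
    have h1 := hd γ A h (φ ∘ₗ ρ (γ t)) x
    rw [← sub_self t] at h1
    have h2 := HasDerivAt.comp_sub_const t t h1
    refine h2.congr_of_eventuallyEq (Filter.Eventually.of_forall fun s => ?_)
    simp only [LinearMap.comp_apply, ← Module.End.mul_apply, ← map_mul, ← hγ]
    rw [add_sub_cancel]
  have hiter : ∀ n, iteratedDeriv n (fun s => φ (ρ (γ s) w)) =
      fun s => φ (ρ (γ s) ((d A ^ n) w)) := fun n => by
    induction n with
    | zero => simp
    | succ n ih =>
      rw [iteratedDeriv_succ, ih]
      ext s
      rw [(hderiv _ s).deriv, pow_succ', Module.End.mul_apply]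
  have hmem : ∀ n, (d A ^ n) w ∈ W := fun n => by
    induction n with
    | zero => simpa
    | succ n ih => rw [pow_succ', Module.End.mul_apply]; exact hW _ ih
  rw [← Complex.taylorSeries_eq_of_entire' 0 t fun s => (hderiv w s).differentiableAt]
  have : ∀ n, φ ((d A ^ n) w) = 0 := fun n =>
    (Submodule.mem_dualAnnihilator φ).1 hφ _ (hmem n)
  simp [hiter, h.1, this]

end Differential

/-! ### Generation of the group by half-turns, and passage from Lie algebra to group. -/

section CartanDieudonne

/-- The reflection in the hyperplane orthogonal to a unit vector `u`. -/
def refl (u : Fin 5 → ℂ) : Matrix (Fin 5) (Fin 5) ℂ := 1 - (2 : ℂ) • Matrix.vecMulVec u u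

theorem refl_mulVec (u x : Fin 5 → ℂ) : (refl u).mulVec x = x - (2 * (u ⬝ᵥ x)) • u := by
  simp [refl, Matrix.sub_mulVec, Matrix.smul_mulVec, Matrix.vecMulVec_mulVec, mul_smul]

theorem refl_transpose (u : Fin 5 → ℂ) : (refl u).transpose = refl u := by
  simp [refl, Matrix.transpose_vecMulVec]

theorem refl_mul_self {u : Fin 5 → ℂ} (hu : u ⬝ᵥ u = 1) : refl u * refl u = 1 := by
  simp only [refl, mul_sub, sub_mul, smul_mul_assoc, mul_smul_comm,
    Matrix.vecMulVec_mul_vecMulVec, hu, one_smul, mul_one, one_mul]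
  module

theorem det_refl {u : Fin 5 → ℂ} (hu : u ⬝ᵥ u = 1) : (refl u).det = -1 := by
  have : refl u = 1 + Matrix.vecMulVec ((-2 : ℂ) • u) u := by
    rw [refl, Matrix.smul_vecMulVec, neg_smul, sub_eq_add_neg]
  rw [this, Matrix.vecMulVec_eq Unit, Matrix.det_one_add_replicateCol_mul_replicateRow,
    dotProduct_smul, hu]
  norm_num

/-- The reflection is the one in $v-w$. Its norm $2-2\,v\cdot w$ is nonzero by hypothesis, so it can
be normalised by a square root. -/
theorem exists_refl_mulVec_eq {v w : Fin 5 → ℂ} (hv : v ⬝ᵥ v = 1) (hw : w ⬝ᵥ w = 1)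
    (hvw : v ⬝ᵥ w ≠ 1) : ∃ u, u ⬝ᵥ u = 1 ∧ (refl u).mulVec v = w ∧
      ∀ x, x ⬝ᵥ v = x ⬝ᵥ w → (refl u).mulVec x = x := by
  have hwv : w ⬝ᵥ v = v ⬝ᵥ w := dotProduct_comm _ _
  obtain ⟨c, hc⟩ := IsAlgClosed.exists_pow_nat_eq (2 - 2 * (v ⬝ᵥ w)) (n := 2) (by norm_num)
  have hc2 : c ^ 2 ≠ 0 := by
    rw [hc]; intro h; apply hvw; linear_combination -h / 2
  have hc0 : c ≠ 0 := fun h => hc2 (by simp [h])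
  refine ⟨c⁻¹ • (v - w), ?_, ?_, fun x hx => ?_⟩
  · simp only [smul_dotProduct, dotProduct_smul, sub_dotProduct, dotProduct_sub, hv, hw, hwv,
      smul_eq_mul]
    field_simp
    linear_combination -hc
  · rw [refl_mulVec]
    have : (2 * ((c⁻¹ • (v - w)) ⬝ᵥ v)) * c⁻¹ = 1 := by
      simp only [smul_dotProduct, sub_dotProduct, hv, hwv, smul_eq_mul]
      field_simp
      linear_combination -hc
    rw [smul_smul, this]
    simp
  · rw [refl_mulVec]
    simp [dotProduct_comm _ x, hx]

/-- Cartan–Dieudonné by induction on the number $k$ of basis vectors that may move: reflections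
bring the image of the last one back without disturbing those already fixed. -/
theorem exists_list_refl (k : ℕ) (hk : k ≤ 5) : ∀ g : Matrix (Fin 5) (Fin 5) ℂ,
    g.transpose * g = 1 →
    (∀ j : Fin 5, k ≤ j.1 → g.mulVec (Pi.single j 1) = Pi.single j 1) →
    ∃ l : List (Fin 5 → ℂ), (∀ u ∈ l, u ⬝ᵥ u = 1) ∧ g = (l.map refl).prod := by
  induction k with
  | zero =>
    intro g _ h
    refine ⟨[], by simp, ?_⟩
    ext i j
    have := congr_fun (h j (Nat.zero_le _)) i
    simpa [Matrix.one_apply, Pi.single_apply] using this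
  | succ k ih =>
    intro g hg hfix
    let e : Fin 5 → Fin 5 → ℂ := fun j => Pi.single j 1
    let a : Fin 5 := ⟨k, by omega⟩
    have hdot : ∀ x y, g.mulVec x ⬝ᵥ g.mulVec y = x ⬝ᵥ y := fun x y => by
      rw [Matrix.dotProduct_mulVec, Matrix.vecMul_mulVec, ← Matrix.dotProduct_mulVec, hg,
        Matrix.one_mulVec]
    have hee : ∀ i j, e i ⬝ᵥ e j = if i = j then 1 else 0 := single_dotProduct_single
    have hva : g.mulVec (e a) ⬝ᵥ g.mulVec (e a) = 1 := by rw [hdot, hee, if_pos rfl]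
    have hja : ∀ j : Fin 5, k + 1 ≤ j.1 → j ≠ a := fun j hj h => by
      rw [h] at hj; simp [a] at hj
    have hjv : ∀ j : Fin 5, k + 1 ≤ j.1 → e j ⬝ᵥ g.mulVec (e a) = 0 := fun j hj => by
      conv_lhs => rw [show e j = g.mulVec (e j) from (hfix j hj).symm]
      rw [hdot, hee, if_neg (hja j hj)]
    have step : ∀ s : Matrix (Fin 5) (Fin 5) ℂ, s.transpose * s = 1 →
        s.mulVec (g.mulVec (e a)) = e a → (∀ j : Fin 5, k + 1 ≤ j.1 → s.mulVec (e j) = e j) →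
        ∃ l : List (Fin 5 → ℂ), (∀ u ∈ l, u ⬝ᵥ u = 1) ∧ s * g = (l.map refl).prod := by
      intro s hs hsa hsj
      refine ih (by omega) (s * g) ?_ fun j hj => ?_
      · rw [Matrix.transpose_mul, mul_assoc, ← mul_assoc s.transpose, hs, one_mul, hg]
      · rw [← Matrix.mulVec_mulVec]
        rcases Nat.eq_or_lt_of_le hj with h | h
        · rw [show j = a from Fin.ext h.symm]; exact hsa
        · rw [hfix j h]; exact hsj j h
    -- Here the difference of the two vectors is isotropic, so no reflection in it exists; the
    -- detour goes to $-e_a$ and then reflects in $e_a$.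
    by_cases hvw : g.mulVec (e a) ⬝ᵥ e a = 1
    · have hvw' : g.mulVec (e a) ⬝ᵥ (-e a) ≠ 1 := by
        rw [dotProduct_neg, hvw]; norm_num
      obtain ⟨u, hu, huv, hux⟩ := exists_refl_mulVec_eq hva (by simp [hee]) hvw'
      have hea : e a ⬝ᵥ e a = 1 := by simp [hee]
      obtain ⟨l, hl, hl'⟩ := step (refl (e a) * refl u) (by
          rw [Matrix.transpose_mul, refl_transpose, refl_transpose, mul_assoc,
            ← mul_assoc (refl (e a)), refl_mul_self hea, one_mul, refl_mul_self hu])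
        (by rw [← Matrix.mulVec_mulVec, huv, refl_mulVec, dotProduct_neg, hea]; module)
        (fun j hj => by
          rw [← Matrix.mulVec_mulVec, hux, refl_mulVec, hee, if_neg (hja j hj).symm]
          · simp
          · rw [hjv j hj, dotProduct_neg, hee, if_neg (hja j hj), neg_zero])
      refine ⟨u :: e a :: l, by simp [hu, hea]; exact hl, ?_⟩
      rw [List.map_cons, List.map_cons, List.prod_cons, List.prod_cons, ← hl', mul_assoc,
        ← mul_assoc (refl (e a)), refl_mul_self hea, one_mul, ← mul_assoc, refl_mul_self hu,
        one_mul]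
    · obtain ⟨u, hu, huv, hux⟩ := exists_refl_mulVec_eq hva (by simp [hee]) hvw
      obtain ⟨l, hl, hl'⟩ := step (refl u) (by rw [refl_transpose, refl_mul_self hu]) huv
        (fun j hj => hux _ (by rw [hjv j hj, hee, if_neg (hja j hj)]))
      refine ⟨u :: l, by simp [hu]; exact hl, ?_⟩
      rw [List.map_cons, List.prod_cons, ← hl', ← mul_assoc, refl_mul_self hu, one_mul]

/-- The orthogonal complement of $\langle u,v\rangle$ has dimension at least 3. If it were totally
isotropic it would lie in its own complement, of dimension at most 2; so it contains a vector that
can be normalised. -/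
theorem exists_unit_orthogonal (u v : Fin 5 → ℂ) :
    ∃ x : Fin 5 → ℂ, x ⬝ᵥ x = 1 ∧ u ⬝ᵥ x = 0 ∧ v ⬝ᵥ x = 0 := by
  classical
  let B : LinearMap.BilinForm ℂ (Fin 5 → ℂ) := Matrix.toBilin' 1
  have hB : ∀ x y, B x y = x ⬝ᵥ y := fun x y => by simp [B, Matrix.toBilin'_apply']
  have hnd : B.Nondegenerate := 
    LinearMap.BilinForm.nondegenerate_toBilin'_of_det_ne_zero' 1 (by simp)
  let W : Submodule ℂ (Fin 5 → ℂ) := Submodule.span ℂ {u, v}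
  have hW : Module.finrank ℂ W ≤ 2 := by
    have := finrank_span_finset_le_card (R := ℂ) ({u, v} : Finset (Fin 5 → ℂ))
    rw [Finset.coe_insert, Finset.coe_singleton] at this
    exact this.trans Finset.card_le_two
  have h1 := LinearMap.BilinForm.finrank_orthogonal hnd W
  have h2 := LinearMap.BilinForm.finrank_orthogonal hnd (B.orthogonal W)
  rw [Module.finrank_fin_fun] at h1 h2
  by_contra! hcon
  have hiso : ∀ x ∈ B.orthogonal W, x ⬝ᵥ x = 0 := fun x hx => by
    by_contra h
    obtain ⟨c, hc⟩ := IsAlgClosed.exists_pow_nat_eq (x ⬝ᵥ x) (n := 2) (by norm_num)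
    have hc0 : c ≠ 0 := fun h' => h (by rw [← hc, h']; norm_num)
    have hx' := LinearMap.BilinForm.mem_orthogonal_iff.1 hx
    have hux : u ⬝ᵥ x = 0 := by
      rw [← hB]; exact hx' u (Submodule.subset_span (by simp))
    have hvx : v ⬝ᵥ x = 0 := by
      rw [← hB]; exact hx' v (Submodule.subset_span (by simp))
    refine hcon (c⁻¹ • x) ?_ (by simp [hux]) (by simp [hvx])
    simp only [smul_dotProduct, dotProduct_smul, smul_eq_mul, ← hc]
    field_simp
  have hle : B.orthogonal W ≤ B.orthogonal (B.orthogonal W) := fun x hx => by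
    rw [LinearMap.BilinForm.mem_orthogonal_iff]
    intro y hy
    have := hiso _ (Submodule.add_mem _ hx hy)
    rw [add_dotProduct, dotProduct_add, dotProduct_add, hiso x hx, hiso y hy,
      dotProduct_comm x y] at this
    change B y x = 0
    rw [hB]
    linear_combination this / 2
  have := Submodule.finrank_mono hle
  omega

theorem rotMatrix_pi {u v : Fin 5 → ℂ} (hu : u ⬝ᵥ u = 1) (hv : v ⬝ᵥ v = 1) (huv : u ⬝ᵥ v = 0) :
    rotMatrix u v Real.pi = refl u * refl v := by
  rw [rotMatrix, wedge_mul_wedge hu hv huv]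
  simp only [refl, mul_sub, sub_mul, smul_mul_assoc, mul_smul_comm,
    Matrix.vecMulVec_mul_vecMulVec, huv, mul_one, one_mul, Complex.sin_pi, Complex.cos_pi]
  simp
  module

/-- `SO₅(ℂ)` is generated by the half-turns. -/
theorem submonoid_eq_top (S : Submonoid G)
    (hS : ∀ (u v : Fin 5 → ℂ) (hu : u ⬝ᵥ u = 1) (hv : v ⬝ᵥ v = 1) (huv : u ⬝ᵥ v = 0),
      rot hu hv huv Real.pi ∈ S) (g : G) : g ∈ S := by
  have even : ∀ n, ∀ l : List (Fin 5 → ℂ), (∀ u ∈ l, u ⬝ᵥ u = 1) → l.length = 2 * n →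
      ∃ s ∈ S, s.1 = (l.map refl).prod := by
    intro n
    induction n with
    | zero =>
      intro l _ hlen
      rw [List.length_eq_zero_iff.1 hlen]
      exact ⟨1, S.one_mem, rfl⟩
    | succ n ih =>
      intro l hl hlen
      match l, hl, hlen with
      | u :: v :: l, hl, hlen =>
        obtain ⟨s, hs, hs'⟩ := ih l (fun x hx => hl x (by simp [hx])) (by
          simp only [List.length_cons] at hlen; omega)
        have hu := hl u (by simp)
        have hv := hl v (by simp)
        -- Two reflections in arbitrary unit vectors become two half-turns by inserting the square
        -- of the reflection in $x\perp u,v$.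
        obtain ⟨x, hx, hux, hvx⟩ := exists_unit_orthogonal u v
        refine ⟨rot hu hx hux Real.pi * rot hx hv (by rw [dotProduct_comm, hvx]) Real.pi * s,
          S.mul_mem (S.mul_mem (hS ..) (hS ..)) hs, ?_⟩
        rw [Submonoid.coe_mul, Submonoid.coe_mul, hs']
        change rotMatrix u x Real.pi * rotMatrix x v Real.pi * _ = _
        rw [rotMatrix_pi hu hx hux, rotMatrix_pi hx hv (by rw [dotProduct_comm, hvx])]
        simp only [List.map_cons, List.prod_cons, mul_assoc]
        rw [← mul_assoc (refl x), refl_mul_self hx, one_mul]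
  obtain ⟨l, hl, hgl⟩ := exists_list_refl 5 le_rfl g.1 (transpose_mul_coe g)
    (fun j hj => absurd j.2 (by omega))
  have hdet : g.1.det = 1 := (Matrix.mem_specialOrthogonalGroup_iff.1 g.2).2
  have hdet' : ∀ l : List (Fin 5 → ℂ), (∀ u ∈ l, u ⬝ᵥ u = 1) →
      (l.map refl).prod.det = (-1) ^ l.length := by
    intro l
    induction l with
    | nil => simp
    | cons u l ih =>
      intro h
      rw [List.map_cons, List.prod_cons, Matrix.det_mul, det_refl (h u (by simp)),
        ih fun x hx => h x (by simp [hx]), List.length_cons, pow_succ']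
  rw [hgl, hdet' l hl] at hdet
  have hev : Even l.length := by
    by_contra h
    rw [Nat.not_even_iff_odd] at h
    rw [h.neg_one_pow] at hdet
    norm_num at hdet
  obtain ⟨n, hn⟩ := hev
  obtain ⟨s, hs, hs'⟩ := even n l hl (by omega)
  rwa [show g = s from Subtype.ext (hgl.trans hs'.symm)]

end CartanDieudonne

variable {V : Type*} [AddCommGroup V] [Module ℂ V] {ρ : Representation ℂ G V}
  {d : Matrix (Fin 5) (Fin 5) ℂ →ₗ[ℂ] Module.End ℂ V}

/-- A subspace that is stable under the Lie algebra is stable under the group. -/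
theorem IsDifferential.mem_of_stable (hd : IsDifferential ρ d) {W : Submodule ℂ V}
    (hW : ∀ A : Matrix (Fin 5) (Fin 5) ℂ, A.transpose = -A → ∀ w ∈ W, d A w ∈ W) (g : G) :
    ∀ w ∈ W, ρ g w ∈ W := by
  let S : Submonoid G :=
    { carrier := {g | ∀ w ∈ W, ρ g w ∈ W}
      one_mem' := by simp
      mul_mem' := fun {a b} ha hb w hw => by
        rw [map_mul, Module.End.mul_apply]; exact ha _ (hb _ hw) }
  exact submonoid_eq_top S (fun u v hu hv huv w hw =>
    hd.oneParam_mem (hasTangent_rot hu hv huv) (rot_add hu hv huv)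
      (hW _ (wedge_transpose u v)) hw _) g

theorem eq_top_of_stable (hirr : ρ.IsIrreducible) {W : Submodule ℂ V}
    (hW : ∀ g, ∀ w ∈ W, ρ g w ∈ W) (hne : W ≠ ⊥) : W = ⊤ := by
  let W' : Subrepresentation ρ := ⟨W, fun g w hw => hW g w hw⟩
  rcases hirr.eq_bot_or_eq_top W' with h | h
  · exact absurd (congr_arg Subrepresentation.toSubmodule h) hne
  · exact congr_arg Subrepresentation.toSubmodule h

end SO5

/-! ### Root vectors, torus and Borel subgroup in an isotropic frame. -/

namespace SO5

/-- The isotropic vector `e₀ - i e₁`. -/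
noncomputable def coisoVec₁ : Fin 5 → ℂ := ![1, -Complex.I, 0, 0, 0]

/-- The isotropic vector `e₂ - i e₃`. -/
noncomputable def coisoVec₂ : Fin 5 → ℂ := ![0, 0, 1, -Complex.I, 0]

/-- The anisotropic vector `e₄`. -/
def anisoVec : Fin 5 → ℂ := ![0, 0, 0, 0, 1]

/-- The first basis vector of the Lie algebra of the torus. -/
noncomputable def H₁ : Matrix (Fin 5) (Fin 5) ℂ := (1 / 2 : ℂ) • wedge isoVec₁ coisoVec₁

/-- The second basis vector of the Lie algebra of the torus. -/
noncomputable def H₂ : Matrix (Fin 5) (Fin 5) ℂ := (1 / 2 : ℂ) • wedge isoVec₂ coisoVec₂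

/-- The positive roots `ε₁ + ε₂`, `ε₁ - ε₂`, `ε₁`, `ε₂`. -/
def root : Fin 4 → ℤ × ℤ := ![(1, 1), (1, -1), (1, 0), (0, 1)]

/-- The coroots of the positive roots. -/
def coroot : Fin 4 → ℤ × ℤ := ![(1, 1), (1, -1), (2, 0), (0, 2)]

/-- The positive root vectors. -/
noncomputable def rootE : Fin 4 → Matrix (Fin 5) (Fin 5) ℂ :=
  ![(1 / 2 : ℂ) • wedge isoVec₁ isoVec₂, (1 / 2 : ℂ) • wedge isoVec₁ coisoVec₂,
    wedge isoVec₁ anisoVec, wedge isoVec₂ anisoVec]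

/-- The negative root vectors. -/
noncomputable def rootF : Fin 4 → Matrix (Fin 5) (Fin 5) ℂ :=
  ![(1 / 2 : ℂ) • wedge coisoVec₂ coisoVec₁, (1 / 2 : ℂ) • wedge isoVec₂ coisoVec₁,
    wedge anisoVec coisoVec₁, wedge anisoVec coisoVec₂]

theorem rootE_skew (i : Fin 4) : (rootE i).transpose = -rootE i := by
  fin_cases i <;> simp [rootE, wedge_transpose]

theorem rootF_skew (i : Fin 4) : (rootF i).transpose = -rootF i := by
  fin_cases i <;> simp [rootF, wedge_transpose]

theorem frame_dotProduct :
    isoVec₁ ⬝ᵥ isoVec₁ = 0 ∧ isoVec₁ ⬝ᵥ isoVec₂ = 0 ∧ isoVec₁ ⬝ᵥ coisoVec₁ = 2 ∧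
    isoVec₁ ⬝ᵥ coisoVec₂ = 0 ∧ isoVec₁ ⬝ᵥ anisoVec = 0 ∧
    isoVec₂ ⬝ᵥ isoVec₁ = 0 ∧ isoVec₂ ⬝ᵥ isoVec₂ = 0 ∧ isoVec₂ ⬝ᵥ coisoVec₁ = 0 ∧
    isoVec₂ ⬝ᵥ coisoVec₂ = 2 ∧ isoVec₂ ⬝ᵥ anisoVec = 0 ∧
    coisoVec₁ ⬝ᵥ isoVec₁ = 2 ∧ coisoVec₁ ⬝ᵥ isoVec₂ = 0 ∧ coisoVec₁ ⬝ᵥ coisoVec₁ = 0 ∧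
    coisoVec₁ ⬝ᵥ coisoVec₂ = 0 ∧ coisoVec₁ ⬝ᵥ anisoVec = 0 ∧
    coisoVec₂ ⬝ᵥ isoVec₁ = 0 ∧ coisoVec₂ ⬝ᵥ isoVec₂ = 2 ∧ coisoVec₂ ⬝ᵥ coisoVec₁ = 0 ∧
    coisoVec₂ ⬝ᵥ coisoVec₂ = 0 ∧ coisoVec₂ ⬝ᵥ anisoVec = 0 ∧
    anisoVec ⬝ᵥ isoVec₁ = 0 ∧ anisoVec ⬝ᵥ isoVec₂ = 0 ∧ anisoVec ⬝ᵥ coisoVec₁ = 0 ∧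
    anisoVec ⬝ᵥ coisoVec₂ = 0 ∧ anisoVec ⬝ᵥ anisoVec = 1 := by
  simp [isoVec₁, isoVec₂, coisoVec₁, coisoVec₂, anisoVec]
  norm_num

theorem wedge_mulVec (u v x : Fin 5 → ℂ) :
    (wedge u v).mulVec x = (v ⬝ᵥ x) • u - (u ⬝ᵥ x) • v := by
  simp [wedge, Matrix.sub_mulVec, Matrix.vecMulVec_mulVec]

theorem wedge_smul_smul (a b : ℂ) (u v : Fin 5 → ℂ) :
    wedge (a • u) (b • v) = (a * b) • wedge u v := by
  simp [wedge, Matrix.smul_vecMulVec, Matrix.vecMulVec_smul, smul_sub, smul_smul, mul_comm]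

section TorusAction

variable (z w : ℂˣ)

theorem torus_isoVec₁ : (torus z w).1.mulVec isoVec₁ = (z : ℂ) • isoVec₁ := by
  ext i
  fin_cases i <;>
    simp [torus, torusMatrix, isoVec₁, Matrix.mulVec, dotProduct, Fin.sum_univ_succ] <;>
    ring_nf <;> simp [Complex.I_sq] <;> ring

theorem torus_coisoVec₁ : (torus z w).1.mulVec coisoVec₁ = (z : ℂ)⁻¹ • coisoVec₁ := by
  ext i
  fin_cases i <;>
    simp [torus, torusMatrix, coisoVec₁, Matrix.mulVec, dotProduct, Fin.sum_univ_succ] <;>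
    ring_nf <;> simp [Complex.I_sq] <;> ring

theorem torus_isoVec₂ : (torus z w).1.mulVec isoVec₂ = (w : ℂ) • isoVec₂ := by
  ext i
  fin_cases i <;>
    simp [torus, torusMatrix, isoVec₂, Matrix.mulVec, dotProduct, Fin.sum_univ_succ] <;>
    ring_nf <;> simp [Complex.I_sq] <;> ring

theorem torus_coisoVec₂ : (torus z w).1.mulVec coisoVec₂ = (w : ℂ)⁻¹ • coisoVec₂ := by
  ext i
  fin_cases i <;>
    simp [torus, torusMatrix, coisoVec₂, Matrix.mulVec, dotProduct, Fin.sum_univ_succ] <;>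
    ring_nf <;> simp [Complex.I_sq] <;> ring

theorem torus_anisoVec : (torus z w).1.mulVec anisoVec = (1 : ℂ) • anisoVec := by
  ext i
  fin_cases i <;>
    simp [torus, torusMatrix, anisoVec, Matrix.mulVec, dotProduct, Fin.sum_univ_succ]

theorem torus_conj_rootE (i : Fin 4) : (torus z w).1 * rootE i * (torus z w).1.transpose =
    ((z : ℂ) ^ (root i).1 * (w : ℂ) ^ (root i).2) • rootE i := by
  fin_cases i <;>
    simp [rootE, root, mul_wedge_mul, torus_isoVec₁, torus_isoVec₂, torus_coisoVec₂,
      torus_anisoVec, wedge_smul_smul, smul_smul, mul_comm, -one_smul]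

theorem torus_conj_rootF (i : Fin 4) : (torus z w).1 * rootF i * (torus z w).1.transpose =
    ((z : ℂ) ^ (-(root i).1) * (w : ℂ) ^ (-(root i).2)) • rootF i := by
  fin_cases i <;>
    simp [rootF, root, mul_wedge_mul, torus_coisoVec₁, torus_isoVec₂, torus_coisoVec₂,
      torus_anisoVec, wedge_smul_smul, smul_smul, mul_comm, -one_smul]

end TorusAction

/-- The complex exponential with values in the units. -/
noncomputable def expUnit (s : ℂ) : ℂˣ := Units.mk0 (Complex.exp s) (Complex.exp_ne_zero s)

theorem hasDerivAt_cosh_unit :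
    HasDerivAt (fun s => ((expUnit s : ℂ) + (expUnit s : ℂ)⁻¹) / 2) 0 0 := by
  simp only [expUnit, Units.val_mk0, ← Complex.exp_neg]
  refine (((Complex.hasDerivAt_exp 0).fun_add
    ((hasDerivAt_neg (0 : ℂ)).cexp)).div_const 2).congr_deriv (by simp)

theorem hasDerivAt_sinh_unit :
    HasDerivAt (fun s => Complex.I * ((expUnit s : ℂ) - (expUnit s : ℂ)⁻¹) / 2) Complex.I 0 := by
  simp only [expUnit, Units.val_mk0, ← Complex.exp_neg]
  refine ((((Complex.hasDerivAt_exp 0).fun_sub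
    ((hasDerivAt_neg (0 : ℂ)).cexp)).const_mul Complex.I).div_const 2).congr_deriv ?_
  simp; ring

theorem expUnit_zero : expUnit 0 = 1 := by ext; simp [expUnit]

theorem torus_one : torus 1 1 = 1 := by
  apply Subtype.ext
  ext i j
  fin_cases i <;> fin_cases j <;> simp [torus, torusMatrix]

theorem hasTangent_torus₁ : HasTangent (fun s => torus (expUnit s) 1) H₁ := by
  refine ⟨by simp only [expUnit_zero, torus_one], fun i j => ?_⟩
  have h1 := hasDerivAt_cosh_unit
  have h2 := hasDerivAt_sinh_unit
  fin_cases i <;> fin_cases j <;>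
    simp [torus, torusMatrix, H₁, wedge, isoVec₁, coisoVec₁,
      hasDerivAt_const]
  · exact h1
  · exact h2.fun_neg.congr_deriv (by ring)
  · exact h2.congr_deriv (by ring)
  · exact h1.congr_deriv (by ring)

theorem hasTangent_torus₂ : HasTangent (fun s => torus 1 (expUnit s)) H₂ := by
  refine ⟨by simp only [expUnit_zero, torus_one], fun i j => ?_⟩
  have h1 := hasDerivAt_cosh_unit
  have h2 := hasDerivAt_sinh_unit
  fin_cases i <;> fin_cases j <;>
    simp [torus, torusMatrix, H₂, wedge, isoVec₂, coisoVec₂,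
      hasDerivAt_const]
  · exact h1
  · exact h2.fun_neg.congr_deriv (by ring)
  · exact h2.congr_deriv (by ring)
  · exact h1.congr_deriv (by ring)

/-- The exponent 3 is needed for the short roots, whose root vectors have nonzero square. -/
theorem rootE_cube (i : Fin 4) : rootE i * rootE i * rootE i = 0 := by
  fin_cases i <;>
    simp [rootE, wedge, mul_sub, sub_mul, Matrix.vecMulVec_mul_vecMulVec, frame_dotProduct]

/-- The factors $1/2$ on the long root vectors are chosen so that this bracket is exactly the
coroot. -/
theorem bracket_rootE_rootF (i : Fin 4) : rootE i * rootF i - rootF i * rootE i =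
    ((coroot i).1 : ℂ) • H₁ + ((coroot i).2 : ℂ) • H₂ := by
  fin_cases i <;>
    simp [rootE, rootF, H₁, H₂, coroot, wedge, mul_sub, sub_mul, Matrix.vecMulVec_mul_vecMulVec,
      frame_dotProduct] <;>
    module

theorem rootE_isoVec₁ (i : Fin 4) : (rootE i).mulVec isoVec₁ = 0 := by
  fin_cases i <;> simp [rootE, Matrix.smul_mulVec, wedge_mulVec, frame_dotProduct]

theorem rootE_isoVec₂ (i : Fin 4) : ∃ c : ℂ, (rootE i).mulVec isoVec₂ = c • isoVec₁ := by
  refine ⟨if i = 1 then 1 else 0, ?_⟩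
  fin_cases i <;> simp [rootE, Matrix.smul_mulVec, wedge_mulVec, frame_dotProduct]

theorem unipMatrix_mulVec (A : Matrix (Fin 5) (Fin 5) ℂ) (t : ℂ) (x : Fin 5 → ℂ) :
    (unipMatrix A t).mulVec x = x + t • A.mulVec x + (t ^ 2 / 2) • A.mulVec (A.mulVec x) := by
  simp [unipMatrix, Matrix.add_mulVec, Matrix.smul_mulVec]

theorem unip_rootE_mem_borel (i : Fin 4) (t : ℂ) :
    unip (rootE_cube i) (rootE_skew i) t ∈ borel := by
  obtain ⟨c, hc⟩ := rootE_isoVec₂ i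
  have h1 : (unip (rootE_cube i) (rootE_skew i) t).1.mulVec isoVec₁ = isoVec₁ := by
    change (unipMatrix _ _).mulVec _ = _
    simp [unipMatrix_mulVec, rootE_isoVec₁]
  have h2 : (unip (rootE_cube i) (rootE_skew i) t).1.mulVec isoVec₂ =
      isoVec₂ + (t * c) • isoVec₁ := by
    change (unipMatrix _ _).mulVec _ = _
    simp [unipMatrix_mulVec, hc, Matrix.mulVec_smul, rootE_isoVec₁, smul_smul]
  constructor
  · rw [Submodule.map_span, Set.image_singleton, Matrix.mulVecLin_apply, h1]
  · rw [Submodule.map_span, Set.image_pair, Matrix.mulVecLin_apply, Matrix.mulVecLin_apply, h1, h2]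
    apply le_antisymm <;> rw [Submodule.span_le, Set.insert_subset_iff, Set.singleton_subset_iff]
    · exact ⟨Submodule.subset_span (by simp), Submodule.add_mem _ (Submodule.subset_span (by simp))
        (Submodule.smul_mem _ _ (Submodule.subset_span (by simp)))⟩
    · refine ⟨Submodule.subset_span (by simp), ?_⟩
      have := Submodule.sub_mem (Submodule.span ℂ {isoVec₁, isoVec₂ + (t * c) • isoVec₁})
        (Submodule.subset_span (by simp : isoVec₂ + (t * c) • isoVec₁ ∈ _))
        (Submodule.smul_mem _ (t * c) (Submodule.subset_span (by simp : isoVec₁ ∈ _)))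
      rwa [add_sub_cancel_right] at this

theorem wedge_swap (u v : Fin 5 → ℂ) : wedge v u = - wedge u v := by simp [wedge]

/-- The bivector `u ∧ v` as a bilinear function. -/
def wedgeₗ : (Fin 5 → ℂ) →ₗ[ℂ] (Fin 5 → ℂ) →ₗ[ℂ] Matrix (Fin 5) (Fin 5) ℂ :=
  LinearMap.mk₂ ℂ wedge
    (fun u u' v => by simp [wedge, Matrix.add_vecMulVec, Matrix.vecMulVec_add]; abel)
    (fun c u v => by simp [wedge, Matrix.smul_vecMulVec, Matrix.vecMulVec_smul, smul_sub])
    (fun u v v' => by simp [wedge, Matrix.add_vecMulVec, Matrix.vecMulVec_add]; abel)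
    (fun c u v => by simp [wedge, Matrix.smul_vecMulVec, Matrix.vecMulVec_smul, smul_sub])

theorem wedgeₗ_apply (u v : Fin 5 → ℂ) : wedgeₗ u v = wedge u v := rfl

theorem span_frame :
    Submodule.span ℂ {isoVec₁, coisoVec₁, isoVec₂, coisoVec₂, anisoVec} = ⊤ := by
  rw [eq_top_iff]
  intro x _
  have : x = ((x 0 - Complex.I * x 1) / 2) • isoVec₁ + ((x 0 + Complex.I * x 1) / 2) • coisoVec₁ +
      ((x 2 - Complex.I * x 3) / 2) • isoVec₂ + ((x 2 + Complex.I * x 3) / 2) • coisoVec₂ +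
      x 4 • anisoVec := by
    have hI := Complex.I_sq
    ext i
    fin_cases i <;> simp [isoVec₁, isoVec₂, coisoVec₁, coisoVec₂, anisoVec] <;> grind
  rw [this]
  refine Submodule.add_mem _ (Submodule.add_mem _ (Submodule.add_mem _ (Submodule.add_mem _
    ?_ ?_) ?_) ?_) ?_ <;>
  exact Submodule.smul_mem _ _ (Submodule.subset_span (by simp))

/-- The root vectors and the torus span the skew-symmetric matrices. -/
theorem skew_mem {S : Submodule ℂ (Matrix (Fin 5) (Fin 5) ℂ)} (h1 : H₁ ∈ S) (h2 : H₂ ∈ S)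
    (hE : ∀ i, rootE i ∈ S) (hF : ∀ i, rootF i ∈ S) {A : Matrix (Fin 5) (Fin 5) ℂ}
    (hA : A.transpose = -A) : A ∈ S := by
  have half : ∀ B : Matrix (Fin 5) (Fin 5) ℂ, (1 / 2 : ℂ) • B ∈ S → B ∈ S := fun B hB => by
    have := S.smul_mem 2 hB
    rwa [smul_smul, show (2 : ℂ) * (1 / 2) = 1 by norm_num, one_smul] at this
  have swap : ∀ u v, wedge u v ∈ S → wedge v u ∈ S := fun u v h => by
    rw [wedge_swap]; exact S.neg_mem h
  have self : ∀ u, wedge u u ∈ S := fun u => by rw [wedge_self]; exact S.zero_mem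
  have p1 : wedge isoVec₁ coisoVec₁ ∈ S := half _ h1
  have p2 : wedge isoVec₂ coisoVec₂ ∈ S := half _ h2
  have p3 : wedge isoVec₁ isoVec₂ ∈ S := half _ (hE 0)
  have p4 : wedge isoVec₁ coisoVec₂ ∈ S := half _ (hE 1)
  have p5 : wedge isoVec₁ anisoVec ∈ S := hE 2
  have p6 : wedge isoVec₂ anisoVec ∈ S := hE 3
  have p7 : wedge coisoVec₂ coisoVec₁ ∈ S := half _ (hF 0)
  have p8 : wedge isoVec₂ coisoVec₁ ∈ S := half _ (hF 1)
  have p9 : wedge anisoVec coisoVec₁ ∈ S := hF 2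
  have p10 : wedge anisoVec coisoVec₂ ∈ S := hF 3
  have frame : ∀ u ∈ ({isoVec₁, coisoVec₁, isoVec₂, coisoVec₂, anisoVec} : Set (Fin 5 → ℂ)),
      ∀ v ∈ ({isoVec₁, coisoVec₁, isoVec₂, coisoVec₂, anisoVec} : Set (Fin 5 → ℂ)),
      wedge u v ∈ S := by
    simp only [Set.mem_insert_iff, Set.mem_singleton_iff]
    rintro u (rfl | rfl | rfl | rfl | rfl) v (rfl | rfl | rfl | rfl | rfl) <;>
    with_reducible first | exact self _ | assumption | (apply swap; assumption)
  have left : ∀ u, ∀ v ∈ ({isoVec₁, coisoVec₁, isoVec₂, coisoVec₂, anisoVec} : Set (Fin 5 → ℂ)),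
      wedge u v ∈ S := fun u v hv => by
    have : Submodule.span ℂ _ ≤ S.comap (wedgeₗ.flip v) :=
      Submodule.span_le.2 fun u hu => frame u hu v hv
    rw [span_frame] at this
    exact this (Submodule.mem_top (x := u))
  have all : ∀ u v, wedge u v ∈ S := fun u v => by
    have : Submodule.span ℂ _ ≤ S.comap (wedgeₗ u) :=
      Submodule.span_le.2 fun v hv => left u v hv
    rw [span_frame] at this
    exact this (Submodule.mem_top (x := v))
  rw [skew_eq_sum hA]
  exact S.sum_mem fun i _ => S.sum_mem fun j _ => S.smul_mem _ (all _ _)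

end SO5

/-! ### Weight spaces and the highest weight vector. -/

namespace SO5

variable {V : Type*} [AddCommGroup V] [Module ℂ V] {ρ : Representation ℂ G V}
  {d : Matrix (Fin 5) (Fin 5) ℂ →ₗ[ℂ] Module.End ℂ V}

theorem mem_weightSpace {x : V} {p q : ℤ} : x ∈ weightSpace ρ p q ↔
    ∀ z w : ℂˣ, ρ (torus z w) x = ((z : ℂ) ^ p * (w : ℂ) ^ q) • x := Iff.rfl

theorem IsDifferential.rootE_mem (hd : IsDifferential ρ d) (i : Fin 4) {p q : ℤ} {x : V}
    (hx : x ∈ weightSpace ρ p q) :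
    d (rootE i) x ∈ weightSpace ρ (p + (root i).1) (q + (root i).2) := by
  intro z w
  rw [hd.apply_conj _ (rootE_skew i), torus_conj_rootE, hx z w, map_smul, map_smul,
    LinearMap.smul_apply, smul_smul, zpow_add₀ z.ne_zero, zpow_add₀ w.ne_zero]
  congr 1
  ring

theorem IsDifferential.rootF_mem (hd : IsDifferential ρ d) (i : Fin 4) {p q : ℤ} {x : V}
    (hx : x ∈ weightSpace ρ p q) :
    d (rootF i) x ∈ weightSpace ρ (p - (root i).1) (q - (root i).2) := by
  intro z w
  rw [hd.apply_conj _ (rootF_skew i), torus_conj_rootF, hx z w, map_smul, map_smul,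
    LinearMap.smul_apply, smul_smul, sub_eq_add_neg, sub_eq_add_neg, zpow_add₀ z.ne_zero,
    zpow_add₀ w.ne_zero]
  congr 1
  ring

theorem hasDerivAt_expUnit_zpow (p : ℤ) :
    HasDerivAt (fun s => ((expUnit s : ℂˣ) : ℂ) ^ p) p 0 := by
  simp only [expUnit, Units.val_mk0, ← Complex.exp_int_mul]
  exact ((hasDerivAt_id (0 : ℂ)).const_mul (p : ℂ)).cexp.congr_deriv (by simp)

theorem IsDifferential.H₁_apply (hd : IsDifferential ρ d) {p q : ℤ} {x : V}
    (hx : x ∈ weightSpace ρ p q) : d H₁ x = (p : ℂ) • x := by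
  refine eq_of_forall_dual fun φ => (hd _ _ hasTangent_torus₁ φ x).unique ?_
  simp only [mem_weightSpace.1 hx, map_smul, smul_eq_mul, Units.val_one, one_zpow, mul_one]
  exact (hasDerivAt_expUnit_zpow p).mul_const _

theorem IsDifferential.H₂_apply (hd : IsDifferential ρ d) {p q : ℤ} {x : V}
    (hx : x ∈ weightSpace ρ p q) : d H₂ x = (q : ℂ) • x := by
  refine eq_of_forall_dual fun φ => (hd _ _ hasTangent_torus₂ φ x).unique ?_
  simp only [mem_weightSpace.1 hx, map_smul, smul_eq_mul, Units.val_one, one_zpow, one_mul]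
  exact (hasDerivAt_expUnit_zpow q).mul_const _

/-- A single operator $H_1+iH_2$ separates all weights, since $p+iq$ determines the integers $p$ and
$q$. -/
theorem IsDifferential.iSupIndep_weightSpace (hd : IsDifferential ρ d) :
    iSupIndep fun μ : ℤ × ℤ => weightSpace ρ μ.1 μ.2 := by
  have h := Module.End.eigenspaces_iSupIndep (d H₁ + Complex.I • d H₂)
  have hinj : Function.Injective fun μ : ℤ × ℤ => (μ.1 : ℂ) + Complex.I * μ.2 := fun μ ν h => by
    have h1 := congr_arg Complex.re h
    have h2 := congr_arg Complex.im h
    simp at h1 h2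
    exact Prod.ext h1 h2
  refine (h.comp hinj).mono fun μ x hx => ?_
  rw [Function.comp_apply, Module.End.mem_eigenspace_iff, LinearMap.add_apply,
    LinearMap.smul_apply, hd.H₁_apply hx, hd.H₂_apply hx]
  module

/-- By the modular law. It is used to show that a weight space contains nothing beyond the span of
the lowered vectors of that weight. -/
theorem eq_of_iSupIndep {ι : Type*} {U W : ι → Submodule ℂ V} (hW : iSupIndep W)
    (hle : ∀ i, U i ≤ W i) (hU : ⨆ i, U i = ⊤) (i : ι) : W i = U i := by
  refine le_antisymm ?_ (hle i)
  have h1 : U i ⊔ ⨆ (j) (_ : j ≠ i), U j = ⊤ := by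
    rw [eq_top_iff, ← hU]
    refine iSup_le fun j => ?_
    by_cases h : j = i
    · rw [h]; exact le_sup_left
    · exact le_sup_of_le_right (le_iSup₂_of_le j h le_rfl)
  have h2 : (⨆ (j) (_ : j ≠ i), U j) ⊓ W i = ⊥ := by
    rw [← disjoint_iff]
    exact ((hW i).mono_right (iSup₂_mono fun j _ => hle j)).symm
  calc W i = (U i ⊔ ⨆ (j) (_ : j ≠ i), U j) ⊓ W i := by rw [h1, top_inf_eq]
    _ = U i ⊔ (⨆ (j) (_ : j ≠ i), U j) ⊓ W i := sup_inf_assoc_of_le _ (hle i)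
    _ ≤ U i := by rw [h2, sup_bot_eq]

/-- The unipotent group of the root lies in $B$, so $d(E)v$ stays on the line of $v$; but its weight
is shifted by a nonzero root, so it is zero. -/
theorem IsDifferential.rootE_highest (hd : IsDifferential ρ d) {l₁ l₂ : ℤ} {v : V}
    (hv : v ∈ weightSpace ρ l₁ l₂) (hb : ∀ b ∈ borel, ρ b v ∈ ℂ ∙ v) (i : Fin 4) :
    d (rootE i) v = 0 := by
  have hmem : d (rootE i) v ∈ ℂ ∙ v := by
    rw [← Subspace.forall_mem_dualAnnihilator_apply_eq_zero_iff]
    intro φ hφ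
    refine (hd _ _ (hasTangent_unip (rootE_cube i) (rootE_skew i)) φ v).unique ?_
    have : ∀ s, φ (ρ (unip (rootE_cube i) (rootE_skew i) s) v) = 0 := fun s =>
      (Submodule.mem_dualAnnihilator φ).1 hφ _ (hb _ (unip_rootE_mem_borel i s))
    simp only [this]
    exact hasDerivAt_const _ _
  obtain ⟨c, hc⟩ := Submodule.mem_span_singleton.1 hmem
  have hw := hd.rootE_mem i hv
  have e1 := hd.H₁_apply hw
  have e2 := hd.H₂_apply hw
  rw [← hc, map_smul, hd.H₁_apply hv] at e1
  rw [← hc, map_smul, hd.H₂_apply hv] at e2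
  rw [← hc]
  have f1 : ((root i).1 : ℂ) • c • v = 0 := by
    push_cast at e1
    linear_combination (norm := module) -e1
  have f2 : ((root i).2 : ℂ) • c • v = 0 := by
    push_cast at e2
    linear_combination (norm := module) -e2
  fin_cases i <;> simp [root] at f1 f2 ⊢ <;> first | exact f1 | exact f2

/-- The vectors obtained from `v` by applying negative root vectors, with their weights. -/
inductive Lowered (d : Matrix (Fin 5) (Fin 5) ℂ →ₗ[ℂ] Module.End ℂ V) (v : V) (l₁ l₂ : ℤ) :
    V → ℤ × ℤ → Prop
  | base : Lowered d v l₁ l₂ v (l₁, l₂)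
  | step (i : Fin 4) (y : V) (μ : ℤ × ℤ) : Lowered d v l₁ l₂ y μ →
      Lowered d v l₁ l₂ (d (rootF i) y) (μ - root i)

/-- The functionals $\mu_1$ and $\mu_1+\mu_2$ are nonnegative on the positive roots, while
$2\mu_1+\mu_2$ is strictly positive on each of them. -/
theorem Lowered.bounds {v y : V} {l₁ l₂ : ℤ} {μ : ℤ × ℤ} (h : Lowered d v l₁ l₂ y μ) :
    μ.1 ≤ l₁ ∧ μ.1 + μ.2 ≤ l₁ + l₂ ∧ (y = v ∨ 2 * μ.1 + μ.2 < 2 * l₁ + l₂) := by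
  have : ∀ {y μ}, Lowered d v l₁ l₂ y μ → 2 * μ.1 + μ.2 ≤ 2 * l₁ + l₂ := by
    intro y μ h
    induction h with
    | base => simp
    | step i y μ _ ih => fin_cases i <;> simp [root] <;> omega
  induction h with
  | base => simp
  | step i y μ h ih =>
    have := this h
    refine ⟨?_, ?_, Or.inr ?_⟩ <;> fin_cases i <;> simp [root] <;> omega

theorem Lowered.mem_weightSpace (hd : IsDifferential ρ d) {v y : V} {l₁ l₂ : ℤ} {μ : ℤ × ℤ}
    (hv : v ∈ weightSpace ρ l₁ l₂) (h : Lowered d v l₁ l₂ y μ) :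
    y ∈ weightSpace ρ μ.1 μ.2 := by
  induction h with
  | base => exact hv
  | step i y μ _ ih => exact hd.rootF_mem i ih

theorem IsDifferential.iSup_span_lowered (hd : IsDifferential ρ d) (hirr : ρ.IsIrreducible)
    {l₁ l₂ : ℤ} {v : V} (hv0 : v ≠ 0) (hv : v ∈ weightSpace ρ l₁ l₂)
    (hb : ∀ b ∈ borel, ρ b v ∈ ℂ ∙ v) :
    ⨆ μ, Submodule.span ℂ {y | Lowered d v l₁ l₂ y μ} = ⊤ := by
  set W := ⨆ μ, Submodule.span ℂ {y | Lowered d v l₁ l₂ y μ} with hWdef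
  have sub : ∀ {y μ}, Lowered d v l₁ l₂ y μ → y ∈ W := fun {y μ} h =>
    Submodule.mem_iSup_of_mem μ (Submodule.subset_span h)
  have ext : ∀ {f : Module.End ℂ V}, (∀ y μ, Lowered d v l₁ l₂ y μ → f y ∈ W) →
      ∀ w ∈ W, f w ∈ W := fun {f} h w hw => by
    have : W ≤ W.comap f := iSup_le fun μ => Submodule.span_le.2 fun y hy => h y μ hy
    exact this hw
  have hF : ∀ i, ∀ w ∈ W, d (rootF i) w ∈ W := fun i =>
    ext fun y μ h => sub (Lowered.step i y μ h)
  have key : ∀ y μ, Lowered d v l₁ l₂ y μ →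
      ∀ A : Matrix (Fin 5) (Fin 5) ℂ, A.transpose = -A → d A y ∈ W := by
    intro y μ h
    induction h with
    | base =>
      intro A hA
      have hvW : v ∈ W := sub Lowered.base
      refine skew_mem (S := W.comap (d.flip v)) ?_ ?_ ?_ ?_ hA
      · change d H₁ v ∈ W
        rw [hd.H₁_apply hv]; exact W.smul_mem _ hvW
      · change d H₂ v ∈ W
        rw [hd.H₂_apply hv]; exact W.smul_mem _ hvW
      · intro i
        change d (rootE i) v ∈ W
        rw [hd.rootE_highest hv hb]; exact W.zero_mem
      · exact fun i => hF i v hvW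
    -- Commuting $A$ past the lowering operator, $AFy=[A,F]y+FAy$; the induction hypothesis must
    -- therefore cover all skew-symmetric $A$ at once.
    | step i y μ _ ih =>
      intro A hA
      have h1 := hd.bracket hA (rootF_skew i)
      have h2 := ih (A * rootF i - rootF i * A) (by
        simp [Matrix.transpose_mul, hA, rootF_skew i])
      rw [h1, LinearMap.sub_apply] at h2
      have h3 := W.add_mem h2 (hF i _ (ih A hA))
      simpa using h3
  refine eq_top_of_stable hirr (hd.mem_of_stable fun A hA => ext fun y μ h => key y μ h A hA) ?_
  intro h
  have : v ∈ W := sub Lowered.base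
  rw [h] at this
  exact hv0 ((Submodule.mem_bot ℂ).1 this)

theorem IsDifferential.weightSpace_eq_span (hd : IsDifferential ρ d) (hirr : ρ.IsIrreducible)
    {l₁ l₂ : ℤ} {v : V} (hv0 : v ≠ 0) (hv : v ∈ weightSpace ρ l₁ l₂)
    (hb : ∀ b ∈ borel, ρ b v ∈ ℂ ∙ v) (μ : ℤ × ℤ) :
    weightSpace ρ μ.1 μ.2 = Submodule.span ℂ {y | Lowered d v l₁ l₂ y μ} :=
  eq_of_iSupIndep hd.iSupIndep_weightSpace
    (fun _ => Submodule.span_le.2 fun _ hy => Lowered.mem_weightSpace hd hv hy)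
    (hd.iSup_span_lowered hirr hv0 hv hb) μ

theorem IsDifferential.weightSpace_eq_bot (hd : IsDifferential ρ d) (hirr : ρ.IsIrreducible)
    {l₁ l₂ : ℤ} {v : V} (hv0 : v ≠ 0) (hv : v ∈ weightSpace ρ l₁ l₂)
    (hb : ∀ b ∈ borel, ρ b v ∈ ℂ ∙ v) {p q : ℤ} (h : l₁ < p ∨ l₁ + l₂ < p + q) :
    weightSpace ρ p q = ⊥ := by
  rw [hd.weightSpace_eq_span hirr hv0 hv hb (p, q), Submodule.span_eq_bot]
  intro y hy
  have := Lowered.bounds hy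
  simp only at this
  omega

theorem IsDifferential.finrank_weightSpace_highest (hd : IsDifferential ρ d)
    (hirr : ρ.IsIrreducible) {l₁ l₂ : ℤ} {v : V} (hv0 : v ≠ 0) (hv : v ∈ weightSpace ρ l₁ l₂)
    (hb : ∀ b ∈ borel, ρ b v ∈ ℂ ∙ v) : Module.finrank ℂ (weightSpace ρ l₁ l₂) = 1 := by
  have : {y | Lowered d v l₁ l₂ y (l₁, l₂)} = {v} := by
    ext y
    constructor
    · intro h
      rcases (Lowered.bounds h).2.2 with h | h
      · exact h
      · exact absurd h (lt_irrefl _)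
    · rintro rfl
      exact Lowered.base
  rw [hd.weightSpace_eq_span hirr hv0 hv hb (l₁, l₂), this, finrank_span_singleton hv0]

end SO5

/-! ### The Casimir operator. -/

namespace SO5

variable {V : Type*} [AddCommGroup V] [Module ℂ V] {ρ : Representation ℂ G V}
  {d : Matrix (Fin 5) (Fin 5) ℂ →ₗ[ℂ] Module.End ℂ V}

section Casimir

/-- The bivector `eᵢ ∧ eⱼ`. -/
def basisWedge (i j : Fin 5) : Matrix (Fin 5) (Fin 5) ℂ := wedge (Pi.single i 1) (Pi.single j 1)

/-- The sum of the squares of all `eᵢ ∧ eⱼ` in the representation. -/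
def sumSq (d : Matrix (Fin 5) (Fin 5) ℂ →ₗ[ℂ] Module.End ℂ V) : Module.End ℂ V :=
  ∑ i, ∑ j, d (basisWedge i j) * d (basisWedge i j)

theorem conj_basisWedge (g : Matrix (Fin 5) (Fin 5) ℂ) (i j : Fin 5) :
    g * basisWedge i j * g.transpose = ∑ a, ∑ b, (g a i * g b j) • basisWedge a b := by
  rw [basisWedge, mul_wedge_mul]
  have h : ∀ i, g.mulVec (Pi.single i 1) = ∑ a, g a i • Pi.single a 1 := fun i => by
    ext a
    simp [Finset.sum_apply, Pi.single_apply]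
  rw [h, h, ← wedgeₗ_apply]
  simp only [map_sum, map_smul, LinearMap.sum_apply, LinearMap.smul_apply, Finset.smul_sum,
    smul_smul]
  rw [Finset.sum_comm]
  refine Finset.sum_congr rfl fun a _ => Finset.sum_congr rfl fun b _ => ?_
  rw [mul_comm]
  rfl

/-- Conjugation by $g$ transforms the bivectors by $g\otimes g$, and orthogonality of the rows of
$g$ collapses the quadruple sum. -/
theorem IsDifferential.conj_sumSq (hd : IsDifferential ρ d) (g : G) :
    ρ g * sumSq d * ρ g⁻¹ = sumSq d := by
  have hinv : ρ g⁻¹ * ρ g = 1 := by rw [← map_mul, inv_mul_cancel, map_one]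
  have hort : ∀ a c, ∑ i, g.1 a i * g.1 c i = if a = c then 1 else 0 := fun a c => by
    have := congr_fun (congr_fun (mul_transpose_coe g) a) c
    simpa [Matrix.mul_apply, Matrix.one_apply] using this
  have h1 : ∀ i j, ρ g * (d (basisWedge i j) * d (basisWedge i j)) * ρ g⁻¹ =
      ∑ a, ∑ b, ∑ c, ∑ e, ((g.1 a i * g.1 c i) * (g.1 b j * g.1 e j)) •
        (d (basisWedge a b) * d (basisWedge c e)) := fun i j => by
    have h2 := hd.conj g (A := basisWedge i j) (wedge_transpose _ _)
    rw [conj_basisWedge] at h2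
    have h3 : ρ g * (d (basisWedge i j) * d (basisWedge i j)) * ρ g⁻¹ =
        (ρ g * d (basisWedge i j) * ρ g⁻¹) * (ρ g * d (basisWedge i j) * ρ g⁻¹) := by
      simp only [mul_assoc]
      rw [← mul_assoc (ρ g⁻¹) (ρ g), hinv, one_mul]
    rw [h3, h2]
    simp only [map_sum, map_smul]
    rw [Finset.sum_mul]
    refine Finset.sum_congr rfl fun a _ => ?_
    rw [Finset.sum_mul]
    refine Finset.sum_congr rfl fun b _ => ?_
    rw [Finset.mul_sum]
    refine Finset.sum_congr rfl fun c _ => ?_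
    rw [Finset.mul_sum]
    refine Finset.sum_congr rfl fun e _ => ?_
    rw [smul_mul_smul_comm]
    congr 1
    ring
  simp only [sumSq, Finset.mul_sum, Finset.sum_mul, h1]
  have comm : ∀ f : Fin 5 → Fin 5 → Fin 5 → Module.End ℂ V,
      ∑ i, ∑ j, ∑ a, f i j a = ∑ a, ∑ i, ∑ j, f i j a := fun f =>
    (Finset.sum_congr rfl fun i _ => Finset.sum_comm).trans Finset.sum_comm
  rw [comm]
  refine Finset.sum_congr rfl fun a _ => ?_
  rw [comm]
  refine Finset.sum_congr rfl fun b _ => ?_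
  rw [comm, Finset.sum_congr rfl fun c _ => comm _]
  simp only [← Finset.sum_smul, ← Finset.mul_sum, ← Finset.sum_mul, hort]
  simp

/-- The Casimir operator. -/
noncomputable def casimir (d : Matrix (Fin 5) (Fin 5) ℂ →ₗ[ℂ] Module.End ℂ V) : Module.End ℂ V :=
  d H₁ * d H₁ + d H₂ * d H₂ + (d (rootE 0) * d (rootF 0) + d (rootF 0) * d (rootE 0)) +
    (d (rootE 1) * d (rootF 1) + d (rootF 1) * d (rootE 1)) +
    (1 / 2 : ℂ) • (d (rootE 2) * d (rootF 2) + d (rootF 2) * d (rootE 2)) +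
    (1 / 2 : ℂ) • (d (rootE 3) * d (rootF 3) + d (rootF 3) * d (rootE 3))

/-- The orthonormal form shows invariance; the root vector form is the one that can be evaluated on
weight vectors. -/
theorem sumSq_eq : sumSq d = (-2 : ℂ) • casimir d := by
  have hI := Complex.I_sq
  have a1 : isoVec₁ = Pi.single 0 1 + Complex.I • Pi.single 1 1 := by
    ext i; fin_cases i <;> simp [isoVec₁]
  have a2 : isoVec₂ = Pi.single 2 1 + Complex.I • Pi.single 3 1 := by
    ext i; fin_cases i <;> simp [isoVec₂]
  have a3 : coisoVec₁ = Pi.single 0 1 - Complex.I • Pi.single 1 1 := by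
    ext i; fin_cases i <;> simp [coisoVec₁]
  have a4 : coisoVec₂ = Pi.single 2 1 - Complex.I • Pi.single 3 1 := by
    ext i; fin_cases i <;> simp [coisoVec₂]
  have a5 : anisoVec = Pi.single 4 1 := by
    ext i; fin_cases i <;> simp [anisoVec]
  have hw : ∀ i j : Fin 5, wedgeₗ (Pi.single i 1) (Pi.single j 1) = basisWedge i j := fun _ _ => rfl
  have hself : ∀ i, basisWedge i i = 0 := fun i => wedge_self _
  have hswap : ∀ i j, basisWedge j i = -basisWedge i j := fun i j => wedge_swap _ _
  have s10 := hswap 0 1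
  have s20 := hswap 0 2
  have s30 := hswap 0 3
  have s40 := hswap 0 4
  have s21 := hswap 1 2
  have s31 := hswap 1 3
  have s41 := hswap 1 4
  have s32 := hswap 2 3
  have s42 := hswap 2 4
  have s43 := hswap 3 4
  simp only [sumSq, casimir, H₁, H₂, rootE, rootF, Fin.sum_univ_five, Matrix.cons_val,
    ← wedgeₗ_apply, a1, a2, a3, a4, a5]
  simp only [map_add, map_sub, map_smul, map_neg, LinearMap.add_apply, LinearMap.sub_apply,
    LinearMap.smul_apply, hw, hself, s10, s20, s30, s40, s21, s31, s41, s32, s42, s43, map_zero,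
    neg_mul_neg]
  generalize d (basisWedge 0 1) = k01
  generalize d (basisWedge 0 2) = k02
  generalize d (basisWedge 0 3) = k03
  generalize d (basisWedge 0 4) = k04
  generalize d (basisWedge 1 2) = k12
  generalize d (basisWedge 1 3) = k13
  generalize d (basisWedge 1 4) = k14
  generalize d (basisWedge 2 3) = k23
  generalize d (basisWedge 2 4) = k24
  generalize d (basisWedge 3 4) = k34
  simp only [mul_add, add_mul, mul_sub, sub_mul, smul_mul_assoc, mul_smul_comm, mul_neg, neg_mul,
    smul_add, smul_sub, smul_neg, smul_smul, mul_zero, zero_mul, smul_zero]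
  clear a1 a2 a3 a4 a5 hw hself hswap s10 s20 s30 s40 s21 s31 s41 s32 s42 s43
  match_scalars <;> grind

theorem IsDifferential.casimir_comm (hd : IsDifferential ρ d) (g : G) (x : V) :
    casimir d (ρ g x) = ρ g (casimir d x) := by
  have h1 := hd.conj_sumSq g
  rw [sumSq_eq, mul_smul_comm, smul_mul_assoc] at h1
  have h2 := smul_right_injective _ (by norm_num : (-2 : ℂ) ≠ 0) h1
  conv_lhs => rw [← h2]
  simp only [Module.End.mul_apply, ρ.inv_self_apply]

/-- Schur's lemma: the eigenspace is $G$-stable and contains $v$. On $v$ only the torus terms and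
$EFv=[E,F]v$ contribute. -/
theorem IsDifferential.casimir_apply (hd : IsDifferential ρ d) (hirr : ρ.IsIrreducible)
    {l₁ l₂ : ℤ} {v : V} (hv0 : v ≠ 0) (hv : v ∈ weightSpace ρ l₁ l₂)
    (hb : ∀ b ∈ borel, ρ b v ∈ ℂ ∙ v) (x : V) :
    casimir d x = ((l₁ : ℂ) ^ 2 + 3 * l₁ + l₂ ^ 2 + l₂) • x := by
  have hE := hd.rootE_highest hv hb
  have hEF : ∀ i, d (rootE i) (d (rootF i) v) =
      (((coroot i).1 : ℂ) * l₁ + ((coroot i).2 : ℂ) * l₂) • v := fun i => by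
    have := LinearMap.congr_fun (hd.bracket (rootE_skew i) (rootF_skew i)) v
    rw [bracket_rootE_rootF] at this
    simp only [map_add, map_smul, LinearMap.add_apply, LinearMap.smul_apply, LinearMap.sub_apply,
      Module.End.mul_apply, hE, map_zero, sub_zero, hd.H₁_apply hv, hd.H₂_apply hv] at this
    rw [← this]
    module
  have hcv : casimir d v = ((l₁ : ℂ) ^ 2 + 3 * l₁ + l₂ ^ 2 + l₂) • v := by
    simp only [casimir, LinearMap.add_apply, LinearMap.smul_apply, Module.End.mul_apply, hE,
      map_zero, hEF, hd.H₁_apply hv, hd.H₂_apply hv, map_smul]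
    simp only [coroot, Matrix.cons_val]
    push_cast
    module
  have := eq_top_of_stable hirr
    (W := Module.End.eigenspace (casimir d) ((l₁ : ℂ) ^ 2 + 3 * l₁ + l₂ ^ 2 + l₂))
    (fun g w hw => by
      rw [Module.End.mem_eigenspace_iff] at hw ⊢
      rw [hd.casimir_comm, hw, map_smul])
    (fun h => hv0 (by
      rw [← Submodule.mem_bot ℂ, ← h, Module.End.mem_eigenspace_iff]; exact hcv))
  exact Module.End.mem_eigenspace_iff.1 (this ▸ Submodule.mem_top)

end Casimir

/-! ### Traces on weight spaces. -/

section Trace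

theorem trace_restrict_comm [FiniteDimensional ℂ V] {U W : Submodule ℂ V} {f g : Module.End ℂ V}
    (hf : ∀ x ∈ U, f x ∈ W) (hg : ∀ x ∈ W, g x ∈ U) (hgf : ∀ x ∈ U, (g * f) x ∈ U)
    (hfg : ∀ x ∈ W, (f * g) x ∈ W) :
    LinearMap.trace ℂ U ((g * f).restrict hgf) = LinearMap.trace ℂ W ((f * g).restrict hfg) :=
  LinearMap.trace_comp_comm' (f.restrict hf) (g.restrict hg)

theorem IsDifferential.rootEF_mem (hd : IsDifferential ρ d) (i : Fin 4) (p q : ℤ) :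
    ∀ x ∈ weightSpace ρ p q, (d (rootE i) * d (rootF i)) x ∈ weightSpace ρ p q := fun x hx => by
  simpa using hd.rootE_mem i (hd.rootF_mem i hx)

theorem IsDifferential.rootFE_mem (hd : IsDifferential ρ d) (i : Fin 4) (p q : ℤ) :
    ∀ x ∈ weightSpace ρ p q, (d (rootF i) * d (rootE i)) x ∈ weightSpace ρ p q := fun x hx => by
  simpa using hd.rootF_mem i (hd.rootE_mem i hx)

/-- The trace of `E F` on a weight space, for a pair of opposite root vectors `E`, `F`. -/
noncomputable def rootTrace (hd : IsDifferential ρ d) (i : Fin 4) (p q : ℤ) : ℂ :=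
  LinearMap.trace ℂ _ ((d (rootE i) * d (rootF i)).restrict (hd.rootEF_mem i p q))

variable [FiniteDimensional ℂ V]

/-- Cyclicity of the trace for the maps $E:V_\mu\to V_{\mu+\alpha}$ and $F$ back. -/
theorem trace_rootFE (hd : IsDifferential ρ d) (i : Fin 4) (p q : ℤ) :
    LinearMap.trace ℂ _ ((d (rootF i) * d (rootE i)).restrict (hd.rootFE_mem i p q)) =
      rootTrace hd i (p + (root i).1) (q + (root i).2) :=
  trace_restrict_comm (fun _ hx => hd.rootE_mem i hx)
    (fun _ hx => by simpa using hd.rootF_mem i hx) _ _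

/-- The trace of $[E,F]$, which acts on $V_\mu$ by the scalar $\langle\mu,\alpha^\vee\rangle$. -/
theorem rootTrace_sub (hd : IsDifferential ρ d) (i : Fin 4) (p q : ℤ) :
    rootTrace hd i p q - rootTrace hd i (p + (root i).1) (q + (root i).2) =
      ((coroot i).1 * p + (coroot i).2 * q) * Module.finrank ℂ (weightSpace ρ p q) := by
  have key : (d (rootE i) * d (rootF i)).restrict (hd.rootEF_mem i p q) -
      (d (rootF i) * d (rootE i)).restrict (hd.rootFE_mem i p q) =
      (((coroot i).1 : ℂ) * p + (coroot i).2 * q) • LinearMap.id := by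
    ext ⟨x, hx⟩
    have := LinearMap.congr_fun (hd.bracket (rootE_skew i) (rootF_skew i)) x
    rw [bracket_rootE_rootF] at this
    simp only [map_add, map_smul, LinearMap.add_apply, LinearMap.smul_apply, hd.H₁_apply hx,
      hd.H₂_apply hx, LinearMap.sub_apply] at this
    simp only [LinearMap.sub_apply, LinearMap.restrict_apply, Submodule.coe_sub,
      LinearMap.smul_apply, LinearMap.id_apply, Submodule.coe_smul]
    rw [← this]
    module
  rw [← trace_rootFE, rootTrace, ← map_sub, key, map_smul, LinearMap.trace_id, smul_eq_mul]

theorem casimir_trace (hd : IsDifferential ρ d) {c : ℂ} (hc : ∀ x, casimir d x = c • x)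
    (p q : ℤ) : c * Module.finrank ℂ (weightSpace ρ p q) =
      ((p : ℂ) ^ 2 + (q : ℂ) ^ 2) * Module.finrank ℂ (weightSpace ρ p q) +
      (rootTrace hd 0 p q + rootTrace hd 0 (p + 1) (q + 1)) +
      (rootTrace hd 1 p q + rootTrace hd 1 (p + 1) (q - 1)) +
      1 / 2 * (rootTrace hd 2 p q + rootTrace hd 2 (p + 1) q) +
      1 / 2 * (rootTrace hd 3 p q + rootTrace hd 3 p (q + 1)) := by
  have h0 := trace_rootFE hd 0 p q
  have h1 := trace_rootFE hd 1 p q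
  have h2 := trace_rootFE hd 2 p q
  have h3 := trace_rootFE hd 3 p q
  simp only [root, Matrix.cons_val, add_zero, ← sub_eq_add_neg] at h0 h1 h2 h3
  rw [← h0, ← h1, ← h2, ← h3]
  have key : c • (LinearMap.id : Module.End ℂ (weightSpace ρ p q)) =
      ((p : ℂ) ^ 2 + (q : ℂ) ^ 2) • LinearMap.id +
      ((d (rootE 0) * d (rootF 0)).restrict (hd.rootEF_mem 0 p q) +
        (d (rootF 0) * d (rootE 0)).restrict (hd.rootFE_mem 0 p q)) +
      ((d (rootE 1) * d (rootF 1)).restrict (hd.rootEF_mem 1 p q) +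
        (d (rootF 1) * d (rootE 1)).restrict (hd.rootFE_mem 1 p q)) +
      (1 / 2 : ℂ) • ((d (rootE 2) * d (rootF 2)).restrict (hd.rootEF_mem 2 p q) +
        (d (rootF 2) * d (rootE 2)).restrict (hd.rootFE_mem 2 p q)) +
      (1 / 2 : ℂ) • ((d (rootE 3) * d (rootF 3)).restrict (hd.rootEF_mem 3 p q) +
        (d (rootF 3) * d (rootE 3)).restrict (hd.rootFE_mem 3 p q)) := by
    ext ⟨x, hx⟩
    have := hc x
    simp only [casimir, LinearMap.add_apply, LinearMap.smul_apply, Module.End.mul_apply,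
      hd.H₁_apply hx, hd.H₂_apply hx, map_smul] at this
    simp only [LinearMap.add_apply, LinearMap.restrict_apply, Submodule.coe_add,
      LinearMap.smul_apply, LinearMap.id_apply, Submodule.coe_smul, Module.End.mul_apply]
    rw [← this]
    module
  have htr := congr_arg (LinearMap.trace ℂ (weightSpace ρ p q)) key
  simp only [map_add, map_smul, LinearMap.trace_id, smul_eq_mul] at htr
  exact htr

end Trace

/-! ### Weyl group symmetry of the multiplicities. -/

section Weyl

variable [FiniteDimensional ℂ V]

theorem finrank_weightSpace_le {p q p' q' : ℤ} (g : G)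
    (h : ∀ x ∈ weightSpace ρ p q, ρ g x ∈ weightSpace ρ p' q') :
    Module.finrank ℂ (weightSpace ρ p q) ≤ Module.finrank ℂ (weightSpace ρ p' q') := by
  refine LinearMap.finrank_le_finrank_of_injective (f := (ρ g).restrict h) fun x y hxy => ?_
  have : ρ g x = ρ g y := congr_arg Subtype.val hxy
  have h' := congr_arg (ρ g⁻¹) this
  rw [ρ.inv_self_apply, ρ.inv_self_apply] at h'
  exact Subtype.ext h'

/-- The element of the Weyl group exchanging the two coordinates of the torus. -/
def swapMatrix : Matrix (Fin 5) (Fin 5) ℂ :=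
  !![0, 0, 1, 0, 0; 0, 0, 0, 1, 0; 1, 0, 0, 0, 0; 0, 1, 0, 0, 0; 0, 0, 0, 0, 1]

theorem swapMatrix_mem : swapMatrix ∈ Matrix.specialOrthogonalGroup (Fin 5) ℂ := by
  rw [Matrix.mem_specialOrthogonalGroup_iff, Matrix.mem_orthogonalGroup_iff]
  constructor
  · ext i j
    fin_cases i <;> fin_cases j <;> simp [swapMatrix, Matrix.mul_apply, Fin.sum_univ_succ]
  · simp [swapMatrix, Matrix.det_succ_row_zero, Fin.sum_univ_succ, Fin.succAbove]

theorem torus_mul_swap (z w : ℂˣ) :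
    torus z w * ⟨swapMatrix, swapMatrix_mem⟩ = ⟨swapMatrix, swapMatrix_mem⟩ * torus w z := by
  apply Subtype.ext
  change torusMatrix z w * swapMatrix = swapMatrix * torusMatrix w z
  ext i j
  fin_cases i <;> fin_cases j <;>
    simp [swapMatrix, torusMatrix, Matrix.mul_apply, Fin.sum_univ_succ]

/-- The element of the Weyl group inverting the first coordinate of the torus. -/
def negMatrix : Matrix (Fin 5) (Fin 5) ℂ := Matrix.diagonal ![1, -1, 1, 1, -1]

theorem negMatrix_mem : negMatrix ∈ Matrix.specialOrthogonalGroup (Fin 5) ℂ := by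
  rw [Matrix.mem_specialOrthogonalGroup_iff, Matrix.mem_orthogonalGroup_iff]
  constructor
  · ext i j
    fin_cases i <;> fin_cases j <;> simp [negMatrix]
  · simp [negMatrix, Fin.prod_univ_succ]

theorem torus_mul_neg (z w : ℂˣ) :
    torus z w * ⟨negMatrix, negMatrix_mem⟩ = ⟨negMatrix, negMatrix_mem⟩ * torus z⁻¹ w := by
  apply Subtype.ext
  change torusMatrix z w * negMatrix = negMatrix * torusMatrix z⁻¹ w
  ext i j
  fin_cases i <;> fin_cases j <;>
    simp [negMatrix, torusMatrix] <;> ring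

theorem finrank_weightSpace_swap (ρ : Representation ℂ G V) (p q : ℤ) :
    Module.finrank ℂ (weightSpace ρ p q) = Module.finrank ℂ (weightSpace ρ q p) := by
  have : ∀ p q, Module.finrank ℂ (weightSpace ρ p q) ≤ Module.finrank ℂ (weightSpace ρ q p) :=
    fun p q => finrank_weightSpace_le ⟨swapMatrix, swapMatrix_mem⟩ fun x hx z w => by
      rw [← Module.End.mul_apply, ← map_mul, torus_mul_swap, map_mul, Module.End.mul_apply,
        hx w z, map_smul, mul_comm]
  exact le_antisymm (this p q) (this q p)

theorem finrank_weightSpace_neg (ρ : Representation ℂ G V) (p q : ℤ) :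
    Module.finrank ℂ (weightSpace ρ p q) = Module.finrank ℂ (weightSpace ρ (-p) q) := by
  have : ∀ p q, Module.finrank ℂ (weightSpace ρ p q) ≤ Module.finrank ℂ (weightSpace ρ (-p) q) :=
    fun p q => finrank_weightSpace_le ⟨negMatrix, negMatrix_mem⟩ fun x hx z w => by
      rw [← Module.End.mul_apply, ← map_mul, torus_mul_neg, map_mul, Module.End.mul_apply,
        hx z⁻¹ w, map_smul]
      simp
  refine le_antisymm (this p q) ?_
  conv_rhs => rw [← neg_neg p]
  exact this (-p) q

end Weyl

end SO5

/-! ### From the Casimir identity to Weyl's formula and the lattice count. -/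

namespace SO5

section Multiplicities

/-- The coefficients of the product of the character `∑ m μ e^μ` with the Weyl denominator
`∏ (1 - e^(-α))`. -/
def weylNum (m : ℤ → ℤ → ℂ) (p q : ℤ) : ℂ :=
  m p q - m p (q + 1) + m (p + 1) (q + 2) - m (p + 2) (q + 2) - m (p + 1) (q - 1) +
    m (p + 2) (q - 1) - m (p + 3) q + m (p + 3) (q + 1)

/-- The coefficients of the product of the character `∑ m μ e^μ` with the Weyl denominator of the
long roots. -/
def longNum (m : ℤ → ℤ → ℂ) (p q : ℤ) : ℂ :=
  m p q - m (p + 1) (q + 1) - m (p + 1) (q - 1) + m (p + 2) q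

variable {m : ℤ → ℤ → ℂ}

set_option maxHeartbeats 1600000 in
/-- The Casimir element acts on the product of the character and the Weyl denominator as the
Laplace operator. -/
theorem weylNum_laplace {t : Fin 4 → ℤ → ℤ → ℂ} {c : ℂ}
    (h0 : ∀ p q : ℤ, t 0 p q - t 0 (p + 1) (q + 1) = (p + q) * m p q)
    (h1 : ∀ p q : ℤ, t 1 p q - t 1 (p + 1) (q - 1) = (p - q) * m p q)
    (h2 : ∀ p q : ℤ, t 2 p q - t 2 (p + 1) q = 2 * p * m p q)
    (h3 : ∀ p q : ℤ, t 3 p q - t 3 p (q + 1) = 2 * q * m p q)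
    (hC : ∀ p q : ℤ, c * m p q = ((p : ℂ) ^ 2 + (q : ℂ) ^ 2) * m p q +
      (t 0 p q + t 0 (p + 1) (q + 1)) + (t 1 p q + t 1 (p + 1) (q - 1)) +
      1 / 2 * (t 2 p q + t 2 (p + 1) q) + 1 / 2 * (t 3 p q + t 3 p (q + 1))) (p q : ℤ) :
    (c - (p ^ 2 + 3 * p + q ^ 2 + q)) * weylNum m p q = 0 := by
  unfold weylNum
  -- The Casimir identities are weighted by the coefficients of the Weyl denominator. For each root
  -- $\alpha$, the $\mathfrak{sl}_2$ relations are weighted by those of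
  -- $(1+e^{-\alpha})\prod_{\beta\ne\alpha}(1-e^{-\beta})$, which eliminates the traces; the $1/2$
  -- is the short root coefficient in the Casimir.
  linear_combination (norm := (push_cast; ring_nf))
    (hC p q + hC (p + 1) (q + 2) + hC (p + 2) (q - 1) + hC (p + 3) (q + 1) - hC p (q + 1) -
    hC (p + 1) (q - 1) - hC (p + 2) (q + 2) - hC (p + 3) q) + (h0 p q + 2 * h0 (p + 1) (q +
    1) + h0 (p + 2) (q - 1) + h0 (p + 2) (q + 2) + h0 (p + 3) q - h0 p (q + 1) - h0 (p + 1)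
    (q - 1) - h0 (p + 1) (q + 2) - 2 * h0 (p + 2) q - h0 (p + 3) (q + 1)) + (h1 p q + h1 (p
    + 1) (q - 1) + h1 (p + 1) (q + 2) + 2 * h1 (p + 2) (q + 1) + h1 (p + 3) q - h1 p (q + 1)
    - 2 * h1 (p + 1) q - h1 (p + 2) (q - 1) - h1 (p + 2) (q + 2) - h1 (p + 3) (q + 1)) + 1 /
    2 * (h2 p q + 2 * h2 (p + 1) q + h2 (p + 1) (q + 2) + 2 * h2 (p + 2) q + h2 (p + 2) (q +
    2) + h2 (p + 3) q - h2 p (q + 1) - h2 (p + 1) (q - 1) - 2 * h2 (p + 1) (q + 1) - h2 (p +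
    2) (q - 1) - 2 * h2 (p + 2) (q + 1) - h2 (p + 3) (q + 1)) + 1 / 2 * (h3 p q + h3 p (q +
    1) + h3 (p + 2) (q - 1) + 2 * h3 (p + 2) q + 2 * h3 (p + 2) (q + 1) + h3 (p + 2) (q + 2)
    - h3 (p + 1) (q - 1) - 2 * h3 (p + 1) q - 2 * h3 (p + 1) (q + 1) - h3 (p + 1) (q + 2) -
    h3 (p + 3) q - h3 (p + 3) (q + 1))

/-- The shift is by $\delta=(3/2,1/2)$: the reflection is $\mu\mapsto s(\mu+\delta)-\delta$, and the
denominator contributes the sign. -/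
theorem weylNum_swap (hs : ∀ p q, m p q = m q p) (p q : ℤ) :
    weylNum m (q - 1) (p + 1) = -weylNum m p q := by
  unfold weylNum
  linear_combination (norm := ring_nf) hs (q - 1) (p + 1) - hs (q - 1) (p + 2) + hs q (p + 3) -
    hs (q + 1) (p + 3) - hs q p + hs (q + 1) p - hs (q + 2) (p + 1) + hs (q + 2) (p + 2)

theorem weylNum_neg (hn : ∀ p q, m p q = m p (-q)) (p q : ℤ) :
    weylNum m p (-q - 1) = -weylNum m p q := by
  unfold weylNum
  linear_combination (norm := ring_nf) hn p (-q - 1) - hn p (-q) + hn (p + 1) (-q + 1) -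
    hn (p + 2) (-q + 1) - hn (p + 1) (-q - 2) + hn (p + 2) (-q - 2) - hn (p + 3) (-q - 1) +
    hn (p + 3) (-q)

theorem weylNum_eq_longNum (m : ℤ → ℤ → ℂ) (p q : ℤ) : weylNum m p q =
    longNum m p q - longNum m (p + 1) q - longNum m p (q + 1) + longNum m (p + 1) (q + 1) := by
  unfold weylNum longNum
  ring_nf

/-- A function that is antisymmetric under the shifted action of the Weyl group and vanishes on the
dominant chamber is zero. -/
theorem eq_zero_of_antisymm {f : ℤ → ℤ → ℂ} (hs : ∀ p q, f (q - 1) (p + 1) = -f p q)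
    (hn : ∀ p q, f p (-q - 1) = -f p q) (h : ∀ p q, 0 ≤ q → q ≤ p → f p q = 0) (p q : ℤ) :
    f p q = 0 := by
  have hn' : ∀ p q, f (-p - 3) q = -f p q := fun p q => by
    have h1 := hs p q
    have h2 := hn (q - 1) (p + 1)
    have h3 := hs (q - 1) (-(p + 1) - 1)
    rw [show -(p + 1) - 1 - 1 = -p - 3 by ring, sub_add_cancel] at h3
    rw [h3, h2, h1, neg_neg]
  have pos : ∀ p q, 0 ≤ q → -1 ≤ p → f p q = 0 := fun p q hq hp => by
    rcases lt_trichotomy p (q - 1) with h' | h' | h'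
    · rw [← neg_eq_zero, ← hs]
      exact h _ _ (by omega) (by omega)
    -- These points lie on the wall of the shifted reflection, so antisymmetry forces $f=-f$.
    · have := hs p q
      rw [h', sub_add_cancel] at this
      rw [h']
      linear_combination this / 2
    · exact h p q hq (by omega)
  have pos' : ∀ p q, 0 ≤ q → f p q = 0 := fun p q hq => by
    by_cases hp : -1 ≤ p
    · exact pos p q hq hp
    · rw [← neg_eq_zero, ← hn']
      exact pos _ _ hq (by omega)
  by_cases hq : 0 ≤ q
  · exact pos' p q hq
  · rw [← neg_eq_zero, ← hn]
    exact pos' _ _ (by omega)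

/-- The alternating sum of a function on `ℤ²` over the shifted Weyl group orbit of `(a, b)`. -/
def altSum (f : ℤ → ℤ → ℂ) (a b : ℤ) : ℂ :=
  f a b - f a (-b - 1) - f (-a - 3) b + f (-a - 3) (-b - 1) - f (b - 1) (a + 1) +
    f (b - 1) (-a - 2) + f (-b - 2) (a + 1) - f (-b - 2) (-a - 2)

/-- The indicator function of the point `(a, b)`. -/
def point (p q a b : ℤ) : ℂ := if p = a ∧ q = b then 1 else 0

/-- The indicator function of the quadrant with corner `(a, b)`. -/
def quadrant (p q a b : ℤ) : ℂ := if p ≤ a ∧ q ≤ b then 1 else 0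

theorem point_swap (p q a b : ℤ) : point (q - 1) (p + 1) a b = point p q (b - 1) (a + 1) := by
  unfold point
  congr 1
  apply propext
  omega

theorem point_neg (p q a b : ℤ) : point p (-q - 1) a b = point p q a (-b - 1) := by
  unfold point
  congr 1
  apply propext
  omega

theorem point_eq_quadrant (p q a b : ℤ) : point p q a b = quadrant p q a b -
    quadrant (p + 1) q a b - quadrant p (q + 1) a b + quadrant (p + 1) (q + 1) a b := by
  unfold point quadrant
  split_ifs <;> first | omega | norm_num

theorem altSum_point_swap (p q a b : ℤ) :
    altSum (point (q - 1) (p + 1)) a b = -altSum (point p q) a b := by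
  simp only [altSum, point_swap]
  ring_nf

theorem altSum_point_neg (p q a b : ℤ) :
    altSum (point p (-q - 1)) a b = -altSum (point p q) a b := by
  simp only [altSum, point_neg]
  ring_nf

/-- The difference of norms is $(\lambda-\mu,\lambda+\mu+2\delta)$. Expanding $\lambda-\mu$ in the
simple roots $\varepsilon_1-\varepsilon_2$, $\varepsilon_2$ gives nonnegative coefficients times
positive factors. -/
theorem eq_of_norm_eq {p q a b : ℤ} (hq : 0 ≤ q) (hpq : q ≤ p) (hb : 0 ≤ b) (hab : b ≤ a)
    (h1 : p ≤ a) (h2 : p + q ≤ a + b)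
    (h : a ^ 2 + 3 * a + b ^ 2 + b = p ^ 2 + 3 * p + q ^ 2 + q) : p = a ∧ q = b := by
  have key : (a + b - p - q) * (q + b + 1) + (a - p) * (p + a + 2 - q - b) = 0 := by
    linear_combination h
  have n1 : 0 ≤ (a + b - p - q) * (q + b + 1) := mul_nonneg (by omega) (by omega)
  have n2 : 0 ≤ (a - p) * (p + a + 2 - q - b) := mul_nonneg (by omega) (by omega)
  have z1 : (a + b - p - q) * (q + b + 1) = 0 := by omega
  have z2 : (a - p) * (p + a + 2 - q - b) = 0 := by omega
  rcases mul_eq_zero.1 z1 with z1 | z1 <;> rcases mul_eq_zero.1 z2 with z2 | z2 <;> omega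

/-- Weyl's character formula. -/
theorem weylNum_eq {a b : ℤ} (hb : 0 ≤ b) (hab : b ≤ a) (hs : ∀ p q, m p q = m q p)
    (hn : ∀ p q, m p q = m p (-q)) (hv : ∀ p q, a < p ∨ a + b < p + q → m p q = 0)
    (h1 : m a b = 1)
    (hL : ∀ p q : ℤ, ((a ^ 2 + 3 * a + b ^ 2 + b : ℂ) - (p ^ 2 + 3 * p + q ^ 2 + q)) *
      weylNum m p q = 0) (p q : ℤ) : weylNum m p q = altSum (point p q) a b := by
  rw [← sub_eq_zero]
  refine eq_zero_of_antisymm (f := fun p q => weylNum m p q - altSum (point p q) a b)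
    (fun p q => ?_) (fun p q => ?_) (fun p q hq hpq => ?_) p q
  · simp only [weylNum_swap hs, altSum_point_swap]; ring
  · simp only [weylNum_neg hn, altSum_point_neg]; ring
  · have far : ∀ x y, ¬(p = x ∧ q = y) → point p q x y = 0 := fun x y h => if_neg h
    by_cases hpt : p = a ∧ q = b
    -- At $\lambda$ itself the other weights in the denominator expansion exceed the bounds, and the
    -- other orbit points are not dominant.
    · obtain ⟨rfl, rfl⟩ := hpt
      simp only [weylNum, altSum, h1]
      rw [hv p (q + 1) (by omega), hv (p + 1) _ (by omega), hv (p + 2) _ (by omega),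
        hv (p + 1) _ (by omega), hv (p + 2) _ (by omega), hv (p + 3) _ (by omega),
        hv (p + 3) _ (by omega), far _ (-q - 1) (by omega), far (-p - 3) _ (by omega),
        far (-p - 3) _ (by omega), far (q - 1) _ (by omega), far (q - 1) _ (by omega),
        far (-q - 2) _ (by omega), far (-q - 2) _ (by omega)]
      simp [point]
    · have h0 : altSum (point p q) a b = 0 := by
        simp only [altSum]
        rw [far a b hpt, far _ (-b - 1) (by omega), far (-a - 3) _ (by omega),
          far (-a - 3) _ (by omega), far (b - 1) _ (by omega), far (b - 1) _ (by omega),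
          far (-b - 2) _ (by omega), far (-b - 2) _ (by omega)]
        simp
      rw [h0, sub_zero]
      by_cases hbd : p ≤ a ∧ p + q ≤ a + b
      · refine (mul_eq_zero.1 (hL p q)).resolve_left fun h => hpt ?_
        refine eq_of_norm_eq hq hpq hb hab hbd.1 hbd.2 ?_
        rw [sub_eq_zero] at h
        exact_mod_cast h
      · simp only [weylNum]
        rw [hv p q (by omega), hv p (q + 1) (by omega), hv (p + 1) _ (by omega),
          hv (p + 2) _ (by omega), hv (p + 1) _ (by omega), hv (p + 2) _ (by omega),
          hv (p + 3) _ (by omega), hv (p + 3) _ (by omega)]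
        simp

/-- Division by $(1-e^{-\varepsilon_1})(1-e^{-\varepsilon_2})$ is unique among functions vanishing
far out in either positive direction. -/
theorem eq_zero_of_difference {f : ℤ → ℤ → ℂ} {N : ℤ} (hv : ∀ p q, N < p ∨ N < q → f p q = 0)
    (h : ∀ p q, f p q - f (p + 1) q - f p (q + 1) + f (p + 1) (q + 1) = 0) (p q : ℤ) :
    f p q = 0 := by
  have down : ∀ g : ℤ → ℂ, (∀ x, N < x → g x = 0) → (∀ x, g x = g (x + 1)) → ∀ x, g x = 0 := by
    intro g hg hstep x
    have : ∀ n : ℕ, g x = g (x + n) := fun n => by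
      induction n with
      | zero => simp
      | succ n ih => rw [ih, hstep]; push_cast; ring_nf
    rw [this (N + 1 - x).toNat]
    exact hg _ (by omega)
  have h1 : ∀ p q, f p q - f (p + 1) q = 0 := fun p =>
    down (fun q => f p q - f (p + 1) q)
      (fun x hx => by simp only [hv p x (Or.inr hx), hv (p + 1) x (Or.inr hx), sub_zero])
      (fun x => by linear_combination h p x)
  exact down (fun p => f p q) (fun x hx => hv x q (Or.inl hx))
    (fun x => by linear_combination h1 x q) p

theorem longNum_eq {a b : ℤ} (hb : 0 ≤ b) (hab : b ≤ a) (hs : ∀ p q, m p q = m q p)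
    (hv : ∀ p q, a < p ∨ a + b < p + q → m p q = 0)
    (h : ∀ p q, weylNum m p q = altSum (point p q) a b) (p q : ℤ) :
    longNum m p q = altSum (quadrant p q) a b := by
  rw [← sub_eq_zero]
  refine eq_zero_of_difference (f := fun p q => longNum m p q - altSum (quadrant p q) a b)
    -- The bound is $a+1$ rather than $a$ because the orbit contains $(b-1,a+1)$ and `longNum` looks
    -- at $q-1$.
    (N := a + 1) (fun p q hpq => ?_) (fun p q => ?_) p q
  · have hv' : ∀ p q, a < p ∨ a < q → m p q = 0 := fun p q h => by
      rcases h with h | h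
      · exact hv p q (Or.inl h)
      · rw [hs]; exact hv q p (Or.inl h)
    have far : ∀ x y, ¬(p ≤ x ∧ q ≤ y) → quadrant p q x y = 0 := fun x y h => if_neg h
    simp only [longNum, altSum]
    rw [hv' p q (by omega), hv' (p + 1) (q + 1) (by omega), hv' (p + 1) (q - 1) (by omega),
      hv' (p + 2) q (by omega), far a b (by omega), far _ (-b - 1) (by omega),
      far (-a - 3) _ (by omega), far (-a - 3) _ (by omega), far (b - 1) _ (by omega),
      far (b - 1) _ (by omega), far (-b - 2) _ (by omega), far (-b - 2) _ (by omega)]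
    simp
  · have h1 := h p q
    rw [weylNum_eq_longNum] at h1
    simp only [altSum, point_eq_quadrant] at h1 ⊢
    linear_combination h1

theorem altSum_quadrant {a b : ℤ} (hb : 0 ≤ b) (hab : b ≤ a) (j k : ℕ) :
    altSum (quadrant (j + k) (k - j)) a b =
      if b ≤ j + k ∧ (j + k : ℤ) ≤ a ∧ (k : ℤ) ≤ j + b ∧ (j : ℤ) ≤ k + b then 1 else 0 := by
  have far : ∀ x y, ¬((j + k : ℤ) ≤ x ∧ (k - j : ℤ) ≤ y) → quadrant (j + k) (k - j) x y = 0 :=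
    fun x y h => if_neg h
  simp only [altSum]
  -- Since $|k-j|\le j+k$, only three quadrants survive: the one at $(a,b)$, minus the disjoint
  -- parts $k-j<-b$ and $j+k<b$.
  rw [far (-a - 3) _ (by omega), far (-a - 3) _ (by omega), far (b - 1) (-a - 2) (by omega),
    far (-b - 2) _ (by omega), far (-b - 2) _ (by omega)]
  unfold quadrant
  split_ifs <;> first | omega | norm_num

/-- Two telescoping sums invert the long root factors, along $(1,1)$ in $k$ and then along $(1,-1)$
in $j$. -/
theorem eq_sum_longNum {N : ℕ} (hv : ∀ p q, (N : ℤ) ≤ p → m p q = 0) :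
    m 0 0 = ∑ j ∈ Finset.range N, ∑ k ∈ Finset.range N, longNum m (j + k) (k - j) := by
  let n : ℤ → ℤ → ℂ := fun p q => m p q - m (p + 1) (q - 1)
  have h1 : ∀ j : ℕ, ∑ k ∈ Finset.range N, longNum m (j + k) (k - j) = n j (-j) := fun j => by
    have : ∀ k : ℕ, longNum m (j + k) (k - j) =
        n (j + k) (k - j) - n (j + (k + 1 : ℕ)) ((k + 1 : ℕ) - j) := fun k => by
      simp only [longNum, n]
      push_cast
      ring_nf
    rw [Finset.sum_congr rfl fun k _ => this k, Finset.sum_range_sub']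
    simp only [n]
    rw [hv (j + N) _ (by omega), hv (j + N + 1) _ (by omega)]
    simp
  rw [Finset.sum_congr rfl fun j _ => h1 j]
  have : ∀ j : ℕ, n j (-j) = m j (-j) - m (j + 1 : ℕ) (-(j + 1 : ℕ)) := fun j => by
    simp only [n]
    push_cast
    ring_nf
  rw [Finset.sum_congr rfl fun j _ => this j, Finset.sum_range_sub' (fun j : ℕ => m j (-j))]
  rw [hv N _ le_rfl]
  simp

theorem card_strip (b e N : ℕ) (hN : b + e < N) :
    ((Finset.range N ×ˢ Finset.range N).filter fun x =>
      b ≤ x.1 + x.2 ∧ x.1 + x.2 ≤ b + e ∧ x.2 ≤ x.1 + b ∧ x.1 ≤ x.2 + b).card =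
      (e + 1) * b + e / 2 + 1 := by
  induction e with
  | zero =>
    rw [show (0 + 1) * b + 0 / 2 + 1 = (Finset.range (b + 1)).card by simp]
    refine Finset.card_nbij' (fun x => x.1) (fun j => (j, b - j)) ?_ ?_ ?_ ?_
    · intro x; simp; omega
    · intro x; simp; omega
    · rintro ⟨x, y⟩; simp; omega
    · intro x; simp
  | succ e ih =>
    have hsplit : ((Finset.range N ×ˢ Finset.range N).filter fun x =>
        b ≤ x.1 + x.2 ∧ x.1 + x.2 ≤ b + (e + 1) ∧ x.2 ≤ x.1 + b ∧ x.1 ≤ x.2 + b) =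
        ((Finset.range N ×ˢ Finset.range N).filter fun x =>
          b ≤ x.1 + x.2 ∧ x.1 + x.2 ≤ b + e ∧ x.2 ≤ x.1 + b ∧ x.1 ≤ x.2 + b).disjUnion
        ((Finset.range N ×ˢ Finset.range N).filter fun x =>
          x.1 + x.2 = b + (e + 1) ∧ x.2 ≤ x.1 + b ∧ x.1 ≤ x.2 + b)
        (by
          rw [Finset.disjoint_left]
          rintro ⟨x, y⟩
          simp
          omega) := by
      ext ⟨x, y⟩
      simp
      omega
    -- On the line $j+k=b+e+1$ the condition $|k-j|\le b$ reads $e+1\le 2j\le e+1+2b$.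
    have hslice : ((Finset.range N ×ˢ Finset.range N).filter fun x =>
        x.1 + x.2 = b + (e + 1) ∧ x.2 ≤ x.1 + b ∧ x.1 ≤ x.2 + b).card =
        (Finset.Icc ((e + 2) / 2) ((e + 1) / 2 + b)).card := by
      refine Finset.card_nbij' (fun x => x.1) (fun j => (j, b + (e + 1) - j)) ?_ ?_ ?_ ?_
      · rintro ⟨x, y⟩; simp; omega
      · intro x; simp; omega
      · rintro ⟨x, y⟩; simp; omega
      · intro x; simp
    rw [hsplit, Finset.card_disjUnion, ih (by omega), hslice, Nat.card_Icc]
    have : (e + 1 + 1) * b = (e + 1) * b + b := by ring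
    omega

end Multiplicities

end SO5

/-! ### The dimension of the zero weight space. -/

namespace SO5

variable {V : Type*} [AddCommGroup V] [Module ℂ V] [FiniteDimensional ℂ V]

/-- The zero weight space counts the weights `(j + k, k - j)` in the strip cut out by the
restriction of the representation to `SO₄(ℂ)`. -/
theorem finrank_weightSpace_zero (ρ : Representation ℂ G V) (hrat : IsRational ρ)
    (hirr : ρ.IsIrreducible) (b e : ℕ) (hhw : HasHighestWeight ρ (b + e) b) :
    Module.finrank ℂ (weightSpace ρ 0 0) = (e + 1) * b + e / 2 + 1 := by
  obtain ⟨d, hd⟩ := exists_isDifferential hrat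
  obtain ⟨v, hv0, hv, hB⟩ := hhw
  let m : ℤ → ℤ → ℂ := fun p q => Module.finrank ℂ (weightSpace ρ p q)
  have hs : ∀ p q, m p q = m q p := fun p q => by
    simp only [m, finrank_weightSpace_swap ρ p q]
  have hn : ∀ p q, m p q = m p (-q) := fun p q => by
    rw [hs p q, hs p (-q)]
    simp only [m, finrank_weightSpace_neg ρ q p]
  have hvan : ∀ p q : ℤ, (b + e : ℤ) < p ∨ (b + e : ℤ) + b < p + q → m p q = 0 := fun p q h => by
    change (Module.finrank ℂ (weightSpace ρ p q) : ℂ) = 0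
    rw [hd.weightSpace_eq_bot hirr hv0 hv hB h, finrank_bot, Nat.cast_zero]
  have h1 : m (b + e) b = 1 := by
    simp only [m, hd.finrank_weightSpace_highest hirr hv0 hv hB, Nat.cast_one]
  have hcas := casimir_trace hd (hd.casimir_apply hirr hv0 hv hB)
  have hL := weylNum_laplace (m := m) (t := rootTrace hd)
    (fun p q => by simpa [root, coroot] using rootTrace_sub hd 0 p q)
    (fun p q => by simpa [root, coroot, sub_eq_add_neg] using rootTrace_sub hd 1 p q)
    (fun p q => by simpa [root, coroot] using rootTrace_sub hd 2 p q)
    (fun p q => by simpa [root, coroot] using rootTrace_sub hd 3 p q) hcas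
  have hW := weylNum_eq (a := b + e) (b := b) (by omega) (by omega) hs hn hvan h1
    (fun p q => by simpa using hL p q)
  have hM := longNum_eq (by omega) (by omega) hs hvan hW
  have hsum := eq_sum_longNum (m := m) (N := b + e + 1) fun p q h => hvan p q (Or.inl (by omega))
  have hcard := card_strip b e (b + e + 1) (by omega)
  rw [← hcard]
  apply Nat.cast_injective (R := ℂ)
  change m 0 0 = _
  rw [hsum, ← Finset.sum_product', Finset.card_filter, Nat.cast_sum]
  refine Finset.sum_congr rfl fun x _ => ?_
  rw [hM, altSum_quadrant (by omega) (by omega)]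
  norm_cast

end SO5

theorem lemma5p2 {V : Type*} [AddCommGroup V] [Module ℂ V] [FiniteDimensional ℂ V]
    (ρ : Representation ℂ SO5.G V) (hrat : SO5.IsRational ρ) (hirr : ρ.IsIrreducible)
    (l₁ l₂ : ℤ) (h₁₂ : l₂ ≤ l₁) (h₂ : 0 ≤ l₂) (hhw : SO5.HasHighestWeight ρ l₁ l₂) :
    (Even (l₁ + l₂) →
      (Module.finrank ℂ (SO5.weightSpace ρ 0 0) : ℚ) =
        ((l₁ : ℚ) - l₂) * l₂ + ((l₁ : ℚ) + l₂) / 2 + 1) ∧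
    (Odd (l₁ + l₂) →
      (Module.finrank ℂ (SO5.weightSpace ρ 0 0) : ℚ) =
        ((l₁ : ℚ) - l₂) * l₂ + ((l₁ : ℚ) + l₂) / 2 + 1 / 2) := by
  obtain ⟨b, rfl⟩ := Int.eq_ofNat_of_zero_le h₂
  -- With $e=\lambda_1-\lambda_2$, the sum $\lambda_1+\lambda_2=2b+e$ has the parity of $e$, which
  -- resolves the floor $e/2$.
  obtain ⟨e, he⟩ := Int.eq_ofNat_of_zero_le (sub_nonneg.2 h₁₂)
  obtain rfl : l₁ = b + e := by omega
  rw [SO5.finrank_weightSpace_zero ρ hrat hirr b e hhw]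
  constructor
  · rintro ⟨n, hn⟩
    obtain ⟨k, rfl⟩ : ∃ k, e = 2 * k := ⟨e / 2, by omega⟩
    rw [Nat.mul_div_cancel_left k two_pos]
    push_cast
    ring
  · rintro ⟨n, hn⟩
    obtain ⟨k, rfl⟩ : ∃ k, e = 2 * k + 1 := ⟨e / 2, by omega⟩
    rw [show (2 * k + 1) / 2 = k by omega]
    push_cast
    ring
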